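/- **Setting.** A reachability labeling scheme for directed graphs on $n$ nodes consists of an encoder, which assigns to each node $u$ of any directed graph $G$ on $n$ nodes a binary string $\ell_G(u)$ (its label), distinct nodes of $G$ receiving distinct labels, and a decoder, which from $\ell_G(u)$ and $\ell_G(v)$ alone, without any other knowledge of $G$, determines whether there is a directed path (possibly of length zero) from $u$ to $v$ in $G$. Its maximum size is $\max_G\max_u|\ell_G(u)|$ and its average size is $\max_G\frac1n\sum_u|\ell_G(u)|$, where $G$ ranges over all directed graphs on $n$ nodes. The decoder works in constant time if it is implemented by one word RAM program, the same for all $n$, whose number of steps is bounded by a constant independent of $n$. Here words have length $w=\Theta(\log n)$, that is, $w$ is at least a sufficiently large constant times $\log n$ (and may be any such value), the labels are given as two arrays whose entries hold $w$ consecutive bits each, and arithmetic, bitwise operations and shifts on words, comparisons, and accesses to the arrays and to memory take one step each. **Theorem.** There exists a reachability labeling scheme for directed graphs on $n$ nodes, for all $n$, of average size at most $n/4+o(n)$ and maximum size at most $n/2+o(n)$, with a single decoder that works in constant time. Moreover, the average size is optimal up to lower-order terms: every reachability labeling scheme for directed graphs on $n$ nodes (with an arbitrary decoder, which may depend on $n$)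 has average size at least $n/4-o(n)$, where the $o(n)$ term depends only on $n$. -/

import Mathlib

/-! ### Reachability labelings of directed graphs -/

/-- `Reaches G u v`: there is a directed path, possibly of length zero, from `u` to `v` in `G`. -/
def Reaches {V : Type*} (G : Digraph V) (u v : V) : Prop :=
  Relation.ReflTransGen G.Adj u v

/-- The encoder `label` and the decoder `decode` form a reachability labeling scheme for the
directed graphs on `n` nodes: the labels of the nodes of a graph are distinct binary strings, and
the decoder, which sees nothing but the labels of `u` and `v`, tells whether `u` reaches `v`. -/
def IsReachabilityScheme (n : ℕ) (label : Digraph (Fin n) → Fin n → List Bool)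
    (decode : List Bool → List Bool → Bool) : Prop :=
  ∀ G : Digraph (Fin n), Function.Injective (label G) ∧
    ∀ u v : Fin n, decode (label G u) (label G v) = true ↔ Reaches G u v

/-- The average length of the labels of the nodes of one graph on `n` nodes. -/
noncomputable def averageLength {n : ℕ} (l : Fin n → List Bool) : ℝ :=
  (∑ u, ((l u).length : ℝ)) / n

/-! ### The word RAM -/

namespace WordRAM

/-- Binary operations on words. -/
inductive Op
  | add | sub | mul | div | mod | band | bor | bxor | shl | shr

/-- Arithmetic is that of unsigned `w`-bit words: results are taken modulo `2 ^ w`, and shifts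
shift in zeros. -/
def Op.eval {w : ℕ} : Op → BitVec w → BitVec w → BitVec w
  | .add, x, y => x + y
  | .sub, x, y => x - y
  | .mul, x, y => x * y
  | .div, x, y => x / y
  | .mod, x, y => x % y
  | .band, x, y => x &&& y
  | .bor, x, y => x ||| y
  | .bxor, x, y => x ^^^ y
  | .shl, x, y => x <<< y
  | .shr, x, y => x >>> y

/-- The instructions; registers are numbered by natural numbers. -/
inductive Instr
  /-- `d := c` for a constant `c` -/
  | const (d c : ℕ)
  /-- `d :=` the word length of the machine -/
  | wordLength (d : ℕ)
  /-- `d := a` -/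
  | move (d a : ℕ)
  /-- `d := o a b` -/
  | op (o : Op) (d a b : ℕ)
  /-- `d :=` the word of the first input array at index `a` -/
  | readFst (d a : ℕ)
  /-- `d :=` the word of the second input array at index `a` -/
  | readSnd (d a : ℕ)
  /-- `d :=` the word of the working memory at address `a` -/
  | load (d a : ℕ)
  /-- the word of the working memory at address `a` becomes `b` -/
  | store (a b : ℕ)
  /-- go to the instruction number `t` if `a = b` -/
  | jumpEq (a b t : ℕ)
  /-- go to the instruction number `t` if `a < b` -/
  | jumpLt (a b t : ℕ)
  /-- stop and answer `r` -/
  | halt (r : Bool)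

/-- A configuration: the number of the next instruction, the registers, the working memory. -/
structure Config (w : ℕ) where
  pc : ℕ
  reg : ℕ → BitVec w
  mem : BitVec w → BitVec w

/-- The initial configuration. -/
def Config.init (w : ℕ) : Config w where
  pc := 0
  reg := fun _ => 0
  mem := fun _ => 0

/-- Assign `x` to the register `d` and go to the next instruction. -/
def Config.assign {w : ℕ} (s : Config w) (d : ℕ) (x : BitVec w) : Config w where
  pc := s.pc + 1
  reg := Function.update s.reg d x
  mem := s.mem

/-- The bit string `l` as an array of `w`-bit words: entry number `i` holds the bits
`i * w, …, i * w + w - 1` of `l`, the first of them as the least significant bit. Positions beyond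
the end of `l` are filled with zeros. -/
def word (w : ℕ) (l : List Bool) (i : ℕ) : BitVec w :=
  BitVec.ofFnLE fun k : Fin w => l.getD (i * w + k) false

/-- The effect of one instruction on inputs `x`, `y` (`halt` is treated in `run`). -/
def Instr.exec {w : ℕ} (x y : List Bool) (s : Config w) : Instr → Config w
  | .const d c => s.assign d (BitVec.ofNat w c)
  | .wordLength d => s.assign d (BitVec.ofNat w w)
  | .move d a => s.assign d (s.reg a)
  | .op o d a b => s.assign d (o.eval (s.reg a) (s.reg b))
  | .readFst d a => s.assign d (word w x (s.reg a).toNat)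
  | .readSnd d a => s.assign d (word w y (s.reg a).toNat)
  | .load d a => s.assign d (s.mem (s.reg a))
  | .store a b => { s with pc := s.pc + 1, mem := Function.update s.mem (s.reg a) (s.reg b) }
  | .jumpEq a b t => { s with pc := if s.reg a = s.reg b then t else s.pc + 1 }
  | .jumpLt a b t => { s with pc := if (s.reg a).toNat < (s.reg b).toNat then t else s.pc + 1 }
  | .halt _ => s

/-- `run P x y T s` is the answer of the program `P` on the inputs `x`, `y`, started from the
configuration `s`, if it halts within `T` steps, and `none` otherwise. -/
def run {w : ℕ} (P : List Instr) (x y : List Bool) : ℕ → Config w → Option Bool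
  | 0, _ => none
  | T + 1, s =>
    match P[s.pc]? with
    | none => none
    | some (.halt r) => some r
    | some i => run P x y T (i.exec x y s)

end WordRAM

/-- The decoder works in constant time on the word RAM with words of logarithmic length: a single
program, the same for all `n` and given only the two labels as arrays of words, answers within a
number `T` of steps that does not depend on `n`, as soon as the word length `w` is at least a
certain constant times `log n`. -/
def ConstantTimeDecoder (label : (n : ℕ) → Digraph (Fin n) → Fin n → List Bool)
    (decode : List Bool → List Bool → Bool) : Prop :=
  ∃ (P : List WordRAM.Instr) (T C : ℕ), ∀ n w : ℕ, C * (Nat.log 2 n + 1) ≤ w →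
    ∀ (G : Digraph (Fin n)) (u v : Fin n),
      WordRAM.run P (label n G u) (label n G v) T (WordRAM.Config.init w) =
        some (decode (label n G u) (label n G v))

/-! By `reaches_iff`, u reaches v exactly when u has at most as many ancestors as v and the two are
linked, i.e. one of them reaches the other. So a label needs one number and a description of the
symmetric relation `Linked`. One of two labels suffices to record a pair: nodes are put into
numbered groups, and a label describes the groups up to its own. Done naively, this takes about n/2
bits on average and n at most.

The second factor of two comes from the choice of groups. A group has two sides of t nodes, and a
side on which all or none of the nodes are linked to v costs v a single bit. If v is mixed to both
sides of few groups only, it spends about t bits per 2t nodes.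

Suitable pairs of sides come from transitivity. Cut the order by number of ancestors into boundedly
many layers. If X and Y lie in different layers and are completely linked, no node outside the
layers from that of X to that of Y is mixed to both (`IsLayered.class_of_mixed`). Given a large X in
one layer, either few nodes of the relevant layers have many neighbours in X, and averaging finds t
elements of X that most of the others avoid; or pigeonhole finds t nodes of one layer with a large
common neighbourhood in X, and fewer layers remain relevant (`IsLayered.exists_pair_aux`). Such
pairs are removed greedily. The few nodes left over, or mixed to both sides of too many groups, form
the first groups (`exists_grouping_of_greedy`).

For constant time, t is a large constant times log log n, so that O(log log n) bits of pointers per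
group are negligible. The decoder is one branch-free arithmetic expression, compiled to a
straight-line program followed by a test for zero.

The lower bound counts: the bipartite graphs between two halves of the nodes have pairwise different
label tuples, and there are about 2^(n²/4) of them, against (L+1)^n 2^L tuples of total length at
most L. -/

/-! ### Arithmetic expressions and their compilation to straight-line programs -/

/-- The number with the `m` binary digits of `l` from position `o` on, least significant first. -/
def bitsAt (l : List Bool) (o m : ℕ) : ℕ :=
  Nat.ofBits fun k : Fin m => l.getD (o + k) false

theorem bitsAt_lt (l : List Bool) (o m : ℕ) : bitsAt l o m < 2 ^ m :=
  Nat.ofBits_lt_two_pow _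

theorem testBit_bitsAt (l : List Bool) (o m j : ℕ) :
    (bitsAt l o m).testBit j = (decide (j < m) && l.getD (o + j) false) := by
  by_cases h : j < m
  · simp [bitsAt, h, Nat.testBit_ofBits_lt]
  · simp [bitsAt, h, Nat.testBit_ofBits_ge _ _ (not_lt.mp h)]

theorem bitsAt_one (l : List Bool) (o : ℕ) : bitsAt l o 1 = (l.getD o false).toNat := by
  apply Nat.eq_of_testBit_eq
  intro j
  rw [testBit_bitsAt]
  rcases j with _ | j
  · cases l.getD o false <;> simp
  · cases l.getD o false <;> simp [Nat.testBit_add_one]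

theorem bitsAt_eq_of_getD {l l' : List Bool} {o o' m : ℕ}
    (h : ∀ j < m, l.getD (o + j) false = l'.getD (o' + j) false) :
    bitsAt l o m = bitsAt l' o' m := by
  apply Nat.eq_of_testBit_eq
  intro j
  simp only [testBit_bitsAt]
  by_cases hj : j < m
  · rw [h j hj]
  · simp [hj]

/-- The power of two given by the number of leading zeros of `l`. -/
def leadingPow (l : List Bool) : ℕ := 2 ^ l.idxOf true

namespace WordRAM

/-- Expressions whose values are natural numbers computed from two bit strings; the Boolean
arguments select one of the two strings. -/
inductive Expr
  | const (c : ℕ)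
  | add (e f : Expr)
  | mul (e f : Expr)
  | div (e f : Expr)
  | lead (b : Bool)
  | bits (b : Bool) (o m : Expr)

namespace Expr

/-- The value of an expression. -/
def eval (x y : List Bool) : Expr → ℕ
  | const c => c
  | add e f => e.eval x y + f.eval x y
  | mul e f => e.eval x y * f.eval x y
  | div e f => e.eval x y / f.eval x y
  | lead b => leadingPow (if b then y else x)
  | bits b o m => bitsAt (if b then y else x) (o.eval x y) (m.eval x y)

/-- All intermediate results fit into words of length `w`. -/
def Fits (w : ℕ) (x y : List Bool) : Expr → Prop
  | const c => c < 2 ^ w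
  | add e f => e.Fits w x y ∧ f.Fits w x y ∧ e.eval x y + f.eval x y < 2 ^ w
  | mul e f => e.Fits w x y ∧ f.Fits w x y ∧ e.eval x y * f.eval x y < 2 ^ w
  | div e f => e.Fits w x y ∧ f.Fits w x y
  | lead b => (if b then y else x).idxOf true < (if b then y else x).length ∧
      (if b then y else x).idxOf true < w
  | bits _ o m => o.Fits w x y ∧ m.Fits w x y ∧ m.eval x y ≤ w

/-- Read a word of one of the two inputs. -/
def readWord (b : Bool) (d a : ℕ) : Instr := if b then .readSnd d a else .readFst d a

/-- A straight-line program that puts the value of an expression into the register `d` and does not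
change the registers below `d`. -/
def compile : Expr → ℕ → List Instr
  | const c, d => [.const d c]
  | add e f, d => e.compile d ++ f.compile (d + 1) ++ [.op .add d d (d + 1)]
  | mul e f, d => e.compile d ++ f.compile (d + 1) ++ [.op .mul d d (d + 1)]
  | div e f, d => e.compile d ++ f.compile (d + 1) ++ [.op .div d d (d + 1)]
  | lead b, d => [.const d 0, readWord b d d, .const (d + 1) 1, .op .sub (d + 1) d (d + 1),
      .op .band (d + 1) d (d + 1), .op .sub d d (d + 1)]
  | bits b o m, d => o.compile d ++ m.compile (d + 1) ++
      [.wordLength (d + 2), .op .div (d + 3) d (d + 2), .op .mod d d (d + 2),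
        readWord b (d + 4) (d + 3), .op .shr (d + 4) (d + 4) d,
        .const (d + 5) 1, .op .add (d + 3) (d + 3) (d + 5), readWord b (d + 3) (d + 3),
        .op .sub d (d + 2) d, .op .shl (d + 3) (d + 3) d, .op .bor (d + 4) (d + 4) (d + 3),
        .op .sub (d + 1) (d + 2) (d + 1), .op .shl (d + 4) (d + 4) (d + 1),
        .op .shr d (d + 4) (d + 1)]

end Expr

/-! ### Execution of straight-line programs -/

/-- The effect of a straight-line program. -/
def execAll {w : ℕ} (x y : List Bool) (l : List Instr) (s : Config w) : Config w :=
  l.foldl (fun s i => i.exec x y s) s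

theorem execAll_append {w : ℕ} (x y : List Bool) (l l' : List Instr) (s : Config w) :
    execAll x y (l ++ l') s = execAll x y l' (execAll x y l s) := by
  simp [execAll]

/-- An instruction that does nothing but assign a value to a register. -/
def Instr.IsAssign : Instr → Prop
  | .store _ _ | .jumpEq _ _ _ | .jumpLt _ _ _ | .halt _ => False
  | _ => True

theorem Instr.IsAssign.pc_exec {w : ℕ} {i : Instr} (h : i.IsAssign) (x y : List Bool)
    (s : Config w) : (i.exec x y s).pc = s.pc + 1 := by
  cases i <;> first | rfl | exact h.elim

theorem pc_execAll {w : ℕ} {l : List Instr} (h : ∀ i ∈ l, i.IsAssign) (x y : List Bool)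
    (s : Config w) : (execAll x y l s).pc = s.pc + l.length := by
  induction l generalizing s with
  | nil => rfl
  | cons i l ih =>
    have := ih (fun j hj => h j (List.mem_cons_of_mem _ hj)) (i.exec x y s)
    simp only [execAll, List.foldl_cons, List.length_cons] at this ⊢
    rw [this, (h i List.mem_cons_self).pc_exec]
    omega

/-- Assignments never jump, so the program counter follows the list; `p` is the part already
executed and grows in the induction. -/
theorem run_append {w : ℕ} {l : List Instr} (h : ∀ i ∈ l, i.IsAssign) (x y : List Bool)
    (p q : List Instr) (T : ℕ) (s : Config w) (hs : s.pc = p.length) :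
    run (p ++ (l ++ q)) x y (T + l.length) s = run (p ++ (l ++ q)) x y T (execAll x y l s) := by
  induction l generalizing s p with
  | nil => rfl
  | cons i l ih =>
    have hi : i.IsAssign := h i List.mem_cons_self
    have key := ih (fun j hj => h j (List.mem_cons_of_mem _ hj)) (p ++ [i]) (i.exec x y s)
      (by simp [hi.pc_exec, hs])
    have e : p ++ [i] ++ (l ++ q) = p ++ (i :: l ++ q) := by simp
    rw [e] at key
    have hget : (p ++ (i :: l ++ q))[s.pc]? = some i := by simp [hs]
    rw [List.length_cons, ← add_assoc, run, hget]
    cases i <;> first | exact key | exact hi.elim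

theorem Expr.isAssign_readWord (b : Bool) (d a : ℕ) : (Expr.readWord b d a).IsAssign := by
  cases b <;> trivial

theorem Expr.isAssign_of_mem_compile (e : Expr) (d : ℕ) : ∀ i ∈ e.compile d, i.IsAssign := by
  induction e generalizing d with
  | const c => simp [compile, Instr.IsAssign]
  | lead b =>
    simp [compile, Instr.IsAssign]
    exact isAssign_readWord ..
  | add e f he hf | mul e f he hf | div e f he hf =>
    intro i hi
    simp only [compile, List.mem_append, List.mem_singleton] at hi
    rcases hi with (hi | hi) | rfl
    · exact he _ _ hi
    · exact hf _ _ hi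
    · trivial
  | bits b e f he hf =>
    intro i hi
    simp only [compile, List.mem_append] at hi
    rcases hi with (hi | hi) | hi
    · exact he _ _ hi
    · exact hf _ _ hi
    · simp only [List.mem_cons, List.not_mem_nil, or_false] at hi
      rcases hi with rfl | rfl | rfl | rfl | rfl | rfl | rfl | rfl | rfl | rfl | rfl | rfl | rfl | rfl
      all_goals first | trivial | exact isAssign_readWord ..

theorem exec_readWord {w : ℕ} (x y : List Bool) (s : Config w) (b : Bool) (d a : ℕ) :
    (Expr.readWord b d a).exec x y s =
      s.assign d (word w (if b then y else x) (s.reg a).toNat) := by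
  cases b <;> rfl

/-! ### Bit manipulation on words -/

theorem getLsbD_word (w : ℕ) (l : List Bool) (i j : ℕ) :
    (word w l i).getLsbD j = (decide (j < w) && l.getD (i * w + j) false) := by
  rw [word, BitVec.getLsbD_ofFnLE]
  by_cases h : j < w <;> simp [h]

/-- Subtracting 1 changes only the lowest set bit and the zeros below it, so the conjunction erases
exactly this bit. -/
theorem land_pred_of_odd_mul_two_pow (i y : ℕ) :
    (2 ^ (i + 1) * y + 2 ^ i) &&& (2 ^ (i + 1) * y + 2 ^ i - 1) = 2 ^ (i + 1) * y := by
  have h1 : 2 ^ i < 2 ^ (i + 1) := Nat.pow_lt_pow_right (by norm_num) (by omega)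
  have h0 : 0 < 2 ^ i := by positivity
  have h2 : 2 ^ i - 1 < 2 ^ (i + 1) := by omega
  apply Nat.eq_of_testBit_eq
  intro j
  have h3 : 2 ^ (i + 1) * y = 2 ^ (i + 1) * y + 0 := rfl
  rw [Nat.testBit_and, Nat.add_sub_assoc h0, Nat.testBit_two_pow_mul_add _ h1,
    Nat.testBit_two_pow_mul_add _ h2]
  conv_rhs => rw [h3, Nat.testBit_two_pow_mul_add _ (by positivity : 0 < 2 ^ (i + 1))]
  by_cases hj : j < i + 1
  · simp only [hj, if_true, Nat.testBit_two_pow, Nat.testBit_two_pow_sub_one, Nat.zero_testBit]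
    by_cases hij : i = j
    · subst hij; simp
    · simp [hij]
  · simp [hj]

theorem lowest_bit {w : ℕ} (v : BitVec w) (i : ℕ) (hi : v.getLsbD i = true)
    (h : ∀ j < i, v.getLsbD j = false) :
    v - (v &&& (v - BitVec.ofNat w 1)) = BitVec.ofNat w (2 ^ i) := by
  have hiw : i < w := BitVec.lt_of_getLsbD hi
  have hd : v.toNat = 2 ^ (i + 1) * (v.toNat / 2 ^ (i + 1)) + 2 ^ i := by
    apply Nat.eq_of_testBit_eq
    intro j
    rw [Nat.testBit_two_pow_mul_add _ (Nat.pow_lt_pow_right (by norm_num) (by omega))]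
    have e : v.toNat.testBit j = v.getLsbD j := rfl
    by_cases hj : j < i + 1
    · rw [if_pos hj, Nat.testBit_two_pow, e]
      by_cases hij : i = j
      · subst hij; simp [hi]
      · rw [h j (by omega)]; simp [hij]
    · rw [if_neg hj, Nat.testBit_div_two_pow, Nat.sub_add_cancel (by omega)]
  set u := v.toNat / 2 ^ (i + 1)
  have h0 : 0 < 2 ^ i := by positivity
  have hv := v.isLt
  have hv' : v = BitVec.ofNat w v.toNat := by simp
  rw [hv', BitVec.ofNat_sub_ofNat_of_le _ _ (Nat.one_lt_two_pow (by omega)) (by omega),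
    ← BitVec.ofNat_and, hd, land_pred_of_odd_mul_two_pow, BitVec.ofNat_sub_ofNat_of_le,
    Nat.add_sub_cancel_left] <;> omega

/-- Since `m ≤ w`, the digits lie within two consecutive words. The last two shifts clear all digits
from `m` on. For `o % w = 0` the second word is shifted out entirely. -/
theorem two_words {w : ℕ} (l : List Bool) (o m : ℕ) (hw : 0 < w) (hm : m ≤ w) :
    (((word w l (o / w) >>> (o % w)) ||| (word w l (o / w + 1) <<< (w - o % w))) <<< (w - m))
      >>> (w - m) = BitVec.ofNat w (bitsAt l o m) := by
  have hmod := Nat.mod_lt o hw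
  have hdm := Nat.div_add_mod o w
  apply BitVec.eq_of_getLsbD_eq
  intro j hj
  simp only [BitVec.getLsbD_ushiftRight, BitVec.getLsbD_shiftLeft, BitVec.getLsbD_or, getLsbD_word,
    BitVec.getLsbD_ofNat, testBit_bitsAt, hj, decide_true, Bool.true_and]
  by_cases hjm : j < m
  · have e1 : w - m + j - (w - m) = j := by omega
    have e2 : w - m + j < w := by omega
    have e3 : ¬ w - m + j < w - m := by omega
    simp only [e1, e2, e3, hj, hjm, decide_true, decide_false, Bool.true_and, Bool.not_false]
    by_cases hc : o % w + j < w
    · have : o / w * w + (o % w + j) = o + j := by rw [mul_comm]; omega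
      have h4 : j < w - o % w := by omega
      simp only [hc, h4, this, decide_true, Bool.true_and, Bool.not_true, Bool.false_and,
        Bool.or_false]
    · have h4 : ¬ j < w - o % w := by omega
      have h5 : j - (w - o % w) < w := by omega
      have : (o / w + 1) * w + (j - (w - o % w)) = o + j := by rw [add_mul, mul_comm]; omega
      simp only [hc, h4, h5, this, decide_true, decide_false, Bool.true_and, Bool.false_and,
        Bool.false_or, Bool.not_false]
  · have e2 : ¬ w - m + j < w := by omega
    simp [hjm, e2]

theorem Expr.Fits.eval_lt {w : ℕ} {x y : List Bool} {e : Expr} (h : e.Fits w x y) :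
    e.eval x y < 2 ^ w := by
  induction e with
  | const c => exact h
  | add e f _ _ => exact h.2.2
  | mul e f _ _ => exact h.2.2
  | div e f he _ => exact lt_of_le_of_lt (Nat.div_le_self _ _) (he h.1)
  | lead b => exact Nat.pow_lt_pow_right (by norm_num) h.2
  | bits b o m _ _ => exact (bitsAt_lt _ _ _).trans_le (Nat.pow_le_pow_right (by norm_num) h.2.2)

theorem getD_idxOf_true {l : List Bool} (h : l.idxOf true < l.length) :
    l.getD (l.idxOf true) false = true := by
  rw [List.getD_eq_getElem _ _ h, List.getElem_idxOf]

theorem getD_of_lt_idxOf_true {l : List Bool} {j : ℕ} (h : j < l.idxOf true) :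
    l.getD j false = false := by
  rw [List.getD_eq_getElem _ _ (h.trans_le List.idxOf_le_length)]
  simpa using List.not_of_lt_findIdx (p := (· == true)) h

theorem execAll_nil {w : ℕ} (x y : List Bool) (s : Config w) : execAll x y [] s = s := rfl

theorem execAll_cons {w : ℕ} (x y : List Bool) (i : Instr) (l : List Instr) (s : Config w) :
    execAll x y (i :: l) s = execAll x y l (i.exec x y s) := rfl

theorem exec_const {w : ℕ} (x y : List Bool) (s : Config w) (d c : ℕ) :
    (Instr.const d c).exec x y s = s.assign d (BitVec.ofNat w c) := rfl

theorem exec_wordLength {w : ℕ} (x y : List Bool) (s : Config w) (d : ℕ) :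
    (Instr.wordLength d).exec x y s = s.assign d (BitVec.ofNat w w) := rfl

theorem exec_op {w : ℕ} (x y : List Bool) (s : Config w) (o : Op) (d a b : ℕ) :
    (Instr.op o d a b).exec x y s = s.assign d (o.eval (s.reg a) (s.reg b)) := rfl

theorem reg_assign {w : ℕ} (s : Config w) (d : ℕ) (v : BitVec w) :
    (s.assign d v).reg = Function.update s.reg d v := rfl

/-- Preserving the registers below `d` makes the induction work: the first operand waits in `d`
while the second is computed in `d + 1`. -/
theorem Expr.compile_spec {w : ℕ} (hw : 1 < w) (x y : List Bool) (e : Expr) (d : ℕ)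
    (s : Config w) (h : e.Fits w x y) :
    (execAll x y (e.compile d) s).reg d = BitVec.ofNat w (e.eval x y) ∧
      ∀ r < d, (execAll x y (e.compile d) s).reg r = s.reg r := by
  induction e generalizing d s with
  | const c =>
    refine ⟨by simp [compile, execAll_cons, execAll_nil, exec_const, reg_assign, eval],
      fun r hr => ?_⟩
    simp [compile, execAll_cons, execAll_nil, exec_const, reg_assign, hr.ne]
  | lead b =>
    have h1 := lowest_bit (word w (if b then y else x) 0) ((if b then y else x).idxOf true)
      (by rw [getLsbD_word]; simp only [h.2, decide_true, Bool.true_and, zero_mul, zero_add]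
          exact getD_idxOf_true h.1)
      (fun j hj => by
        rw [getLsbD_word]; simp only [hj.trans h.2, decide_true, Bool.true_and, zero_mul, zero_add]
        exact getD_of_lt_idxOf_true hj)
    refine ⟨?_, fun r hr => ?_⟩
    · simpa [compile, execAll_cons, execAll_nil, exec_const, exec_op, exec_readWord, reg_assign,
        Op.eval, eval, leadingPow, -BitVec.ofNat_pow] using h1
    · have : r ≠ d + 1 := by omega
      simp [compile, execAll_cons, execAll_nil, exec_const, exec_op, exec_readWord, reg_assign,
        hr.ne, this]
  | add e f he hf =>
    obtain ⟨he1, he2⟩ := he d s h.1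
    obtain ⟨hf1, hf2⟩ := hf (d + 1) (execAll x y (e.compile d) s) h.2.1
    rw [compile, execAll_append, execAll_append]
    refine ⟨?_, fun r hr => ?_⟩
    · simp [execAll_cons, execAll_nil, exec_op, reg_assign, Op.eval] at *
      rw [hf1, hf2 d (by omega), he1, eval, BitVec.ofNat_add]
    · simp [execAll_cons, execAll_nil, exec_op, reg_assign, hr.ne] at *
      rw [hf2 r (by omega), he2 r hr]
  | mul e f he hf =>
    obtain ⟨he1, he2⟩ := he d s h.1
    obtain ⟨hf1, hf2⟩ := hf (d + 1) (execAll x y (e.compile d) s) h.2.1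
    rw [compile, execAll_append, execAll_append]
    refine ⟨?_, fun r hr => ?_⟩
    · simp [execAll_cons, execAll_nil, exec_op, reg_assign, Op.eval] at *
      rw [hf1, hf2 d (by omega), he1, eval, BitVec.ofNat_mul]
    · simp [execAll_cons, execAll_nil, exec_op, reg_assign, hr.ne] at *
      rw [hf2 r (by omega), he2 r hr]
  | div e f he hf =>
    obtain ⟨he1, he2⟩ := he d s h.1
    obtain ⟨hf1, hf2⟩ := hf (d + 1) (execAll x y (e.compile d) s) h.2
    rw [compile, execAll_append, execAll_append]
    refine ⟨?_, fun r hr => ?_⟩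
    · simp [execAll_cons, execAll_nil, exec_op, reg_assign, Op.eval] at *
      rw [hf1, hf2 d (by omega), he1, eval]
      apply BitVec.eq_of_toNat_eq
      have h1 := h.1.eval_lt
      have h2 := h.2.eval_lt
      rw [BitVec.toNat_udiv, BitVec.toNat_ofNat, BitVec.toNat_ofNat, BitVec.toNat_ofNat,
        Nat.mod_eq_of_lt h1, Nat.mod_eq_of_lt h2,
        Nat.mod_eq_of_lt ((Nat.div_le_self _ _).trans_lt h1)]
    · simp [execAll_cons, execAll_nil, exec_op, reg_assign, hr.ne] at *
      rw [hf2 r (by omega), he2 r hr]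
  | bits b o m ho hm =>
    obtain ⟨ho1, ho2⟩ := ho d s h.1
    obtain ⟨hm1, hm2⟩ := hm (d + 1) (execAll x y (o.compile d) s) h.2.1
    rw [compile, execAll_append, execAll_append]
    set s' := execAll x y (m.compile (d + 1)) (execAll x y (o.compile d) s) with hs'
    have hd : s'.reg d = BitVec.ofNat w (o.eval x y) := by rw [hm2 d (by omega), ho1]
    refine ⟨?_, fun r hr => ?_⟩
    · have ho := h.1.eval_lt
      have hmw := h.2.2
      have hww : w < 2 ^ w := Nat.lt_two_pow_self
      have h2 := two_words (if b then y else x) (o.eval x y) (m.eval x y) (by omega) hmw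
      have hmod : o.eval x y % w < w := Nat.mod_lt _ (by omega)
      have e1 : (BitVec.ofNat w (o.eval x y) / BitVec.ofNat w w).toNat = o.eval x y / w := by
        rw [BitVec.toNat_udiv, BitVec.toNat_ofNat, BitVec.toNat_ofNat, Nat.mod_eq_of_lt ho,
          Nat.mod_eq_of_lt hww]
      have e2 : BitVec.ofNat w (o.eval x y) % BitVec.ofNat w w =
          BitVec.ofNat w (o.eval x y % w) := by
        apply BitVec.eq_of_toNat_eq
        rw [BitVec.toNat_umod, BitVec.toNat_ofNat, BitVec.toNat_ofNat, BitVec.toNat_ofNat,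
          Nat.mod_eq_of_lt ho, Nat.mod_eq_of_lt hww, Nat.mod_eq_of_lt (hmod.trans hww)]
      -- The index of the second word does not wrap around: as `w ≥ 2`, the quotient is at most half
      -- of a number below `2 ^ w`.
      have hlt : o.eval x y / w + 1 < 2 ^ w := by
        have : o.eval x y / w * 2 ≤ o.eval x y / w * w := Nat.mul_le_mul_left _ (by omega)
        have h3 := Nat.div_mul_le_self (o.eval x y) w
        have : 2 ^ 2 ≤ 2 ^ w := Nat.pow_le_pow_right (by norm_num) (by omega)
        omega
      have e3 : (BitVec.ofNat w (o.eval x y) / BitVec.ofNat w w + BitVec.ofNat w 1).toNat =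
          o.eval x y / w + 1 := by
        rw [BitVec.toNat_add, e1, BitVec.toNat_ofNat, Nat.mod_eq_of_lt (by omega : 1 < 2 ^ w),
          Nat.mod_eq_of_lt hlt]
      have e4 : BitVec.ofNat w w - BitVec.ofNat w (o.eval x y % w) =
          BitVec.ofNat w (w - o.eval x y % w) :=
        BitVec.ofNat_sub_ofNat_of_le _ _ (by omega) (by omega)
      have e5 : BitVec.ofNat w w - BitVec.ofNat w (m.eval x y) =
          BitVec.ofNat w (w - m.eval x y) :=
        BitVec.ofNat_sub_ofNat_of_le _ _ (by omega) (by omega)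
      have e6 : ∀ a ≤ w, (BitVec.ofNat w a).toNat = a := fun a ha => by
        rw [BitVec.toNat_ofNat, Nat.mod_eq_of_lt (by omega)]
      simp only [execAll_cons, execAll_nil, exec_const, exec_wordLength, exec_op, exec_readWord,
        reg_assign, Op.eval, Function.update_apply, Nat.reduceEqDiff,
        add_right_inj, Nat.add_eq_left, Nat.left_eq_add, if_true, if_false, hd, hm1, eval, e1, e2,
        e3, e4, e5, OfNat.ofNat_ne_zero, one_ne_zero, OfNat.ofNat_ne_one, OfNat.one_ne_ofNat,
        BitVec.shiftLeft_eq', BitVec.ushiftRight_eq', e6 _ hmod.le, e6 _ (Nat.sub_le _ _)]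
      exact h2
    · have hne : ∀ k, r ≠ d + k := by omega
      simp [execAll_cons, execAll_nil, exec_const, exec_wordLength, exec_op, exec_readWord,
        reg_assign, hr.ne, hne]
      rw [hm2 r (by omega), ho2 r hr]

/-- A program that tells whether the value of an expression differs from zero. -/
def Expr.program (e : Expr) : List Instr :=
  (e.compile 0 ++ [.const 1 0]) ++
    [.jumpEq 0 1 ((e.compile 0).length + 3), .halt true, .halt false]

theorem Expr.run_program {w : ℕ} (hw : 1 < w) (x y : List Bool) (e : Expr)
    (h : e.Fits w x y) :
    run e.program x y (2 + (e.compile 0 ++ [Instr.const 1 0]).length) (Config.init w) =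
      some (decide (e.eval x y ≠ 0)) := by
  have hA : ∀ i ∈ e.compile 0 ++ [Instr.const 1 0], i.IsAssign := by
    intro i hi
    rcases List.mem_append.mp hi with hi | hi
    · exact e.isAssign_of_mem_compile 0 i hi
    · rw [List.mem_singleton.mp hi]; trivial
  have h1 := run_append hA x y [] [.jumpEq 0 1 ((e.compile 0).length + 3), .halt true, .halt false]
    2 (Config.init w) rfl
  rw [List.nil_append] at h1
  rw [Expr.program, h1]
  have hpc := pc_execAll hA x y (Config.init w)
  obtain ⟨hr, -⟩ := e.compile_spec hw x y 0 (Config.init w) h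
  have h0 : (execAll x y (e.compile 0 ++ [Instr.const 1 0]) (Config.init w)).reg 0 =
      BitVec.ofNat w (e.eval x y) := by
    simp [execAll_append, execAll_cons, execAll_nil, exec_const, reg_assign, hr]
  have h2 : (execAll x y (e.compile 0 ++ [Instr.const 1 0]) (Config.init w)).reg 1 = 0 := by
    simp [execAll_append, execAll_cons, execAll_nil, exec_const, reg_assign]
  generalize execAll x y (e.compile 0 ++ [Instr.const 1 0]) (Config.init w) = s at *
  have hlen : (e.compile 0).length + 3 = (e.compile 0 ++ [Instr.const 1 0]).length + 2 := by simp
  generalize e.compile 0 ++ [Instr.const 1 0] = A at *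
  have hpc : s.pc = A.length := by simpa [Config.init] using hpc
  have hz : BitVec.ofNat w (e.eval x y) = 0 ↔ e.eval x y = 0 := by
    rw [← BitVec.toNat_inj, BitVec.toNat_ofNat, Nat.mod_eq_of_lt h.eval_lt]
    simp
  by_cases hc : e.eval x y = 0
  · simp [run, hpc, Instr.exec, h0, h2, hc, hlen]
  · have h3 : ¬ BitVec.ofNat w (e.eval x y) = 0#w := mt hz.mp hc
    simp [run, hpc, Instr.exec, h0, h2, h3, hc]

end WordRAM

/-! ### Labels made of fields, pointers and codes of variable length -/

/-- The `m` lowest binary digits of a number. -/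
def toBits (m x : ℕ) : List Bool := List.ofFn fun j : Fin m => x.testBit j

theorem length_toBits (m x : ℕ) : (toBits m x).length = m := by simp [toBits]

theorem getD_ofFn {m : ℕ} (f : ℕ → Bool) {j : ℕ} (hj : j < m) :
    (List.ofFn fun i : Fin m => f i).getD j false = f j := by
  rw [List.getD_eq_getElem _ _ (by simpa using hj)]
  simp

theorem getD_toBits {m x j : ℕ} (hj : j < m) : (toBits m x).getD j false = x.testBit j :=
  getD_ofFn (fun j => x.testBit j) hj

theorem bitsAt_toBits {m x : ℕ} (hx : x < 2 ^ m) : bitsAt (toBits m x) 0 m = x := by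
  apply Nat.eq_of_testBit_eq
  intro j
  rw [testBit_bitsAt, zero_add]
  by_cases hj : j < m
  · rw [getD_toBits hj]; simp [hj]
  · have : x.testBit j = false :=
      Nat.testBit_lt_two_pow (hx.trans_le (Nat.pow_le_pow_right (by norm_num) (by omega)))
    simp [hj, this]

theorem bitsAt_append_right (p l : List Bool) (o m : ℕ) :
    bitsAt (p ++ l) (p.length + o) m = bitsAt l o m :=
  bitsAt_eq_of_getD fun j _ => by
    rw [List.getD_append_right _ _ _ _ (by omega)]
    congr 1
    omega

theorem bitsAt_append_left (l q : List Bool) (o m : ℕ) (h : o + m ≤ l.length) :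
    bitsAt (l ++ q) o m = bitsAt l o m :=
  bitsAt_eq_of_getD fun j hj => List.getD_append _ _ _ _ (by omega)

theorem length_flatMap_toBits (m : ℕ) (xs : List ℕ) :
    (xs.flatMap (toBits m)).length = xs.length * m := by
  induction xs with
  | nil => simp
  | cons x xs ih => simp [ih, length_toBits, add_mul, add_comm]

theorem bitsAt_flatMap_toBits (m : ℕ) (xs : List ℕ) (i x : ℕ) (hi : xs[i]? = some x)
    (hx : x < 2 ^ m) : bitsAt (xs.flatMap (toBits m)) (i * m) m = x := by
  induction xs generalizing i with
  | nil => simp at hi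
  | cons y xs ih =>
    rw [List.flatMap_cons]
    rcases i with _ | i
    · have : y = x := by simpa using hi
      rw [zero_mul, bitsAt_append_left _ _ _ _ (by simp [length_toBits]), this, bitsAt_toBits hx]
    · have := bitsAt_append_right (toBits m y) (xs.flatMap (toBits m)) (i * m) m
      rw [length_toBits] at this
      rw [add_mul, one_mul, add_comm, this]
      exact ih i (by simpa using hi)

theorem getD_flatten_map_range (c : ℕ → List Bool) (K i o : ℕ) (hi : i < K)
    (ho : o < (c i).length) :
    ((List.range K).map c).flatten.getD ((∑ j ∈ Finset.range i, (c j).length) + o) false =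
      (c i).getD o false := by
  induction K with
  | zero => omega
  | succ K ih =>
    have hlen : ∀ K, ((List.range K).map c).flatten.length =
        ∑ j ∈ Finset.range K, (c j).length := by
      intro K
      induction K with
      | zero => simp
      | succ K ih =>
        rw [List.range_succ, List.map_append, List.flatten_append, List.length_append, ih,
          Finset.sum_range_succ]
        simp
    rw [List.range_succ, List.map_append, List.flatten_append]
    rcases Nat.lt_succ_iff_lt_or_eq.mp hi with h | rfl
    · rw [List.getD_append, ih h]
      rw [hlen]
      calc _ < ∑ j ∈ Finset.range (i + 1), (c j).length := by
            rw [Finset.sum_range_succ]; omega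
        _ ≤ _ := Finset.sum_le_sum_of_subset (Finset.range_subset_range.mpr h)
    · rw [List.getD_append_right _ _ _ _ (by rw [hlen]; omega), hlen, Nat.add_sub_cancel_left]
      simp

/-- The content of the label of a node. The nodes are arranged in groups; a group has two sides,
each with positions `0, …, t - 1`. The label knows for each group with number at most `grp` and for
each of its sides whether the side is described bit by bit (`explicit`) or by a single default bit
(`default`). -/
structure LabelData where
  k : ℕ
  t : ℕ
  rank : ℕ
  grp : ℕ
  side : Bool
  pos : ℕ
  explicit : ℕ → Bool → Bool
  default : ℕ → Bool → Bool
  bit : ℕ → Bool → ℕ → Bool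

namespace LabelData

variable (D : LabelData)

/-- What the label tells about a position of a group. -/
def value (i : ℕ) (s : Bool) (p : ℕ) : Bool :=
  if D.explicit i s then D.bit i s p else D.default i s

/-- The description of one group. -/
def code (i : ℕ) : List Bool :=
  [D.default i false, D.default i true, D.explicit i false, D.explicit i true] ++
    (if D.explicit i false then List.ofFn fun p : Fin D.t => D.bit i false p else []) ++
    (if D.explicit i true then List.ofFn fun p : Fin D.t => D.bit i true p else [])

theorem length_code (i : ℕ) :
    (D.code i).length =
      4 + D.t * ((D.explicit i false).toNat + (D.explicit i true).toNat) := by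
  simp only [code]
  cases D.explicit i false <;> cases D.explicit i true <;> simp <;> ring

theorem length_code_le (i : ℕ) : (D.code i).length ≤ 2 * D.t + 4 := by
  rw [length_code]
  cases D.explicit i false <;> cases D.explicit i true <;> simp <;> omega

/-- The position of the description of the group `i` among the descriptions. -/
def start (i : ℕ) : ℕ := ∑ j ∈ Finset.range i, (D.code j).length

/-- The position of the relative pointers. -/
def pointerPos : ℕ := (9 + (D.grp / 2 ^ D.k + 1)) * 2 ^ D.k

/-- The position of the descriptions. -/
def codePos : ℕ := D.pointerPos + (D.grp + 1) * (2 * D.k)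

/-- The fields and the absolute pointers. -/
def fields : List ℕ :=
  [D.rank, D.grp, D.side.toNat, D.pos, D.t, 2 * D.k, D.pointerPos, D.codePos] ++
    (List.range (D.grp / 2 ^ D.k + 1)).map fun j => D.start (j * 2 ^ D.k)

/-- The relative pointers. -/
def pointers : List ℕ :=
  (List.range (D.grp + 1)).map fun i => D.start i - D.start (i / 2 ^ D.k * 2 ^ D.k)

/-- The width of the fields, encoded as the number of leading zeros. -/
def unary : List Bool :=
  List.replicate D.k false ++ true :: List.replicate (2 ^ D.k - D.k - 1) false

/-- The label. -/
def label : List Bool :=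
  D.unary ++ (D.fields.flatMap (toBits (2 ^ D.k)) ++
    (D.pointers.flatMap (toBits (2 * D.k)) ++ ((List.range (D.grp + 1)).map D.code).flatten))

/-- All entries fit into their fields. -/
structure Valid : Prop where
  rank_lt : D.rank < 2 ^ 2 ^ D.k
  pos_lt : D.pos < D.t
  -- A description then has at most `2 ^ k` bits, which lets relative pointers fit into `2 * k`
  -- bits.
  t_le : 2 * D.t + 4 ≤ 2 ^ D.k
  le_k : 4 ≤ D.k
  -- The quarter leaves room for the length per group, so that all positions in the label fit into
  -- `2 ^ k` bits.
  grp_lt : D.grp + 1 < 2 ^ (2 ^ D.k / 4)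

theorem length_unary : D.unary.length = 2 ^ D.k := by
  have : D.k < 2 ^ D.k := Nat.lt_two_pow_self
  simp [unary]
  omega

theorem length_fields : D.fields.length = 8 + (D.grp / 2 ^ D.k + 1) := by
  simp [fields]; omega

theorem length_label :
    D.label.length = D.codePos + D.start (D.grp + 1) := by
  have : ∀ K, ((List.range K).map D.code).flatten.length = D.start K := by
    intro K
    induction K with
    | zero => simp [start]
    | succ K ih =>
      rw [List.range_succ, List.map_append, List.flatten_append, List.length_append, ih, start,
        start, Finset.sum_range_succ]
      simp
  rw [label, List.length_append, List.length_append, List.length_append, length_unary,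
    length_flatMap_toBits, length_flatMap_toBits, length_fields, this, codePos, pointerPos]
  simp [pointers]
  ring

/-- The decoder does not know `n`; it learns the width of the fields from the zeros before the first
`true`. -/
theorem idxOf_label : D.label.idxOf true = D.k := by
  have h : (List.replicate D.k false).idxOf true = D.k := by
    rw [List.idxOf_eq_length (by simp)]; simp
  have h2 : true ∉ List.replicate D.k false := by simp
  rw [label, unary, List.append_assoc, List.idxOf_append_of_notMem h2]
  simp

theorem leadingPow_label : leadingPow D.label = 2 ^ D.k := by
  rw [leadingPow, idxOf_label]

theorem idxOf_lt_length : D.label.idxOf true < D.label.length := by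
  rw [List.idxOf_lt_length_iff]
  simp [label, unary]

theorem bitsAt_field {i x : ℕ} (hi : D.fields[i]? = some x) (hx : x < 2 ^ 2 ^ D.k) :
    bitsAt D.label ((i + 1) * 2 ^ D.k) (2 ^ D.k) = x := by
  obtain ⟨h, -⟩ := List.getElem?_eq_some_iff.mp hi
  have h1 := bitsAt_append_right D.unary (D.fields.flatMap (toBits (2 ^ D.k)) ++
    (D.pointers.flatMap (toBits (2 * D.k)) ++ ((List.range (D.grp + 1)).map D.code).flatten))
    (i * 2 ^ D.k) (2 ^ D.k)
  rw [length_unary] at h1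
  rw [label, add_mul, one_mul, add_comm _ (2 ^ D.k), h1, bitsAt_append_left, bitsAt_flatMap_toBits _ _ _ _ hi hx]
  rw [length_flatMap_toBits]
  calc _ = (i + 1) * 2 ^ D.k := by ring
    _ ≤ _ := Nat.mul_le_mul_right _ h

theorem length_unary_append_fields :
    (D.unary ++ D.fields.flatMap (toBits (2 ^ D.k))).length = D.pointerPos := by
  rw [List.length_append, length_unary, length_flatMap_toBits, length_fields, pointerPos]
  ring

theorem bitsAt_pointer {i x : ℕ} (hi : D.pointers[i]? = some x) (hx : x < 2 ^ (2 * D.k)) :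
    bitsAt D.label (D.pointerPos + i * (2 * D.k)) (2 * D.k) = x := by
  obtain ⟨h, -⟩ := List.getElem?_eq_some_iff.mp hi
  rw [label, ← List.append_assoc, ← length_unary_append_fields, bitsAt_append_right,
    bitsAt_append_left, bitsAt_flatMap_toBits _ _ _ _ hi hx]
  rw [length_flatMap_toBits]
  calc _ = (i + 1) * (2 * D.k) := by ring
    _ ≤ _ := Nat.mul_le_mul_right _ h

theorem bitsAt_code {i o : ℕ} (hi : i ≤ D.grp) (ho : o < (D.code i).length) :
    bitsAt D.label (D.codePos + D.start i + o) 1 = ((D.code i).getD o false).toNat := by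
  have h : (D.unary ++ D.fields.flatMap (toBits (2 ^ D.k)) ++
      D.pointers.flatMap (toBits (2 * D.k))).length = D.codePos := by
    rw [List.length_append, length_unary_append_fields, length_flatMap_toBits, codePos]
    simp [pointers]
  rw [label, ← List.append_assoc, ← List.append_assoc, ← h, add_assoc, bitsAt_append_right,
    bitsAt_one, start, getD_flatten_map_range _ _ _ _ (by omega) ho]

theorem start_le (i : ℕ) : D.start i ≤ i * (2 * D.t + 4) := by
  rw [start]
  refine (Finset.sum_le_card_nsmul _ _ _ fun j _ => D.length_code_le j).trans ?_
  simp

theorem start_mono {i j : ℕ} (h : i ≤ j) : D.start i ≤ D.start j :=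
  Finset.sum_le_sum_of_subset (Finset.range_subset_range.mpr h)

theorem start_sub_le (i j : ℕ) : D.start (j + i) - D.start j ≤ i * (2 * D.t + 4) := by
  rw [start, start, Finset.sum_range_add, Nat.add_sub_cancel_left]
  refine (Finset.sum_le_card_nsmul _ _ _ fun l _ => D.length_code_le (j + l)).trans ?_
  simp

/-! ### Sizes of the stored numbers -/

namespace Valid

variable {D}

theorem le_width (h : D.Valid) : 16 ≤ 2 ^ D.k :=
  calc 16 = 2 ^ 4 := by norm_num
    _ ≤ _ := Nat.pow_le_pow_right (by norm_num) h.le_k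

theorem width_le (h : D.Valid) : 2 * D.k ≤ 2 ^ D.k := by
  obtain ⟨j, hj⟩ := Nat.exists_eq_add_of_le h.le_k
  rw [hj, pow_add]
  have : j < 2 ^ j := Nat.lt_two_pow_self
  omega

theorem grp_lt' (h : D.Valid) : D.grp < 2 ^ 2 ^ D.k := by
  have h1 := h.grp_lt
  have h2 : 2 ^ (2 ^ D.k / 4) ≤ 2 ^ 2 ^ D.k :=
    Nat.pow_le_pow_right (by norm_num) (Nat.div_le_self _ _)
  omega

theorem t_lt (h : D.Valid) : D.t < 2 ^ 2 ^ D.k := by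
  have h1 := h.t_le
  have h2 : 2 ^ D.k < 2 ^ 2 ^ D.k := Nat.lt_two_pow_self
  omega

/-- A relative pointer spans fewer than `2 ^ k` descriptions of at most `2 ^ k` bits each. -/
theorem pointer_lt (h : D.Valid) (i : ℕ) :
    D.start i - D.start (i / 2 ^ D.k * 2 ^ D.k) < 2 ^ (2 * D.k) := by
  have h1 := D.start_sub_le (i % 2 ^ D.k) (i / 2 ^ D.k * 2 ^ D.k)
  have h0 : 0 < 2 ^ D.k := by positivity
  rw [Nat.div_add_mod'] at h1
  calc _ ≤ _ := h1
    _ ≤ (i % 2 ^ D.k) * 2 ^ D.k := Nat.mul_le_mul_left _ h.t_le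
    _ < 2 ^ D.k * 2 ^ D.k := Nat.mul_lt_mul_of_pos_right (Nat.mod_lt _ h0) h0
    _ = _ := by rw [two_mul, pow_add]

theorem codePos_add_start_lt (h : D.Valid) : D.codePos + D.start (D.grp + 1) < 2 ^ 2 ^ D.k := by
  have hk := h.le_k
  have hL := h.le_width
  have h1 := D.start_le (D.grp + 1)
  have h2 : (D.grp + 1) * (2 * D.t + 4) ≤ (D.grp + 1) * 2 ^ D.k := Nat.mul_le_mul_left _ h.t_le
  have h3 : D.grp / 2 ^ D.k * 2 ^ D.k ≤ D.grp := Nat.div_mul_le_self _ _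
  have h4 : 2 * D.k ≤ 2 * 2 ^ D.k := by have : D.k < 2 ^ D.k := Nat.lt_two_pow_self; omega
  have h5 : (D.grp + 1) * (2 * D.k) ≤ (D.grp + 1) * (2 * 2 ^ D.k) := Nat.mul_le_mul_left _ h4
  have h6 : D.codePos + D.start (D.grp + 1) ≤ (D.grp + 1) * (14 * 2 ^ D.k) := by
    rw [codePos, pointerPos]
    nlinarith
  -- With `2 ^ k = 4 * m` there are fewer than `2 ^ m` groups, and the `56 * m` bits per group are
  -- at most `2 ^ (3 * m)`.
  obtain ⟨m, hm⟩ : ∃ m, 2 ^ D.k = 4 * m := by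
    refine ⟨2 ^ (D.k - 2), ?_⟩
    rw [show 4 = 2 ^ 2 by norm_num, ← pow_add]; congr 1; omega
  have h7 := h.grp_lt
  rw [hm, Nat.mul_div_cancel_left _ (by norm_num)] at h7
  have h8 : m < 2 ^ m := Nat.lt_two_pow_self
  have hm4 : 4 ≤ m := by omega
  have h9 : 56 ≤ 2 ^ m * 2 ^ m := by
    have : 2 ^ 4 ≤ 2 ^ m := Nat.pow_le_pow_right (by norm_num) hm4
    nlinarith
  rw [hm] at h6 ⊢
  calc _ ≤ _ := h6
    _ ≤ (D.grp + 1) * (2 ^ m * (2 ^ m * 2 ^ m)) := Nat.mul_le_mul_left _ (by nlinarith)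
    _ < 2 ^ m * (2 ^ m * (2 ^ m * 2 ^ m)) := Nat.mul_lt_mul_of_pos_right h7 (by positivity)
    _ = 2 ^ (4 * m) := by ring

end Valid

end LabelData

/-! ### The decoder -/

namespace WordRAM.Expr

/-- A field of a label. -/
def field (b : Bool) (j : ℕ) : Expr := bits b (mul (const j) (lead b)) (lead b)

/-- The position in a label of the description of a group. -/
def codeStart (b : Bool) (i : Expr) : Expr :=
  add (field b 8)
    (add (bits b (add (mul (const 9) (lead b)) (mul (div i (lead b)) (lead b))) (lead b))
      (bits b (add (field b 7) (mul i (field b 6))) (field b 6)))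

/-- A single bit of the description of a group. -/
def codeBit (b : Bool) (i o : Expr) : Expr := bits b (add (codeStart b i) o) (const 1)

/-- What a label tells about a position of a group. -/
def lookup (b : Bool) (i s p : Expr) : Expr :=
  add
    (mul (codeBit b i (add (const 2) s))
      (codeBit b i (add (const 4) (add (mul s (mul (codeBit b i (const 2)) (field b 5))) p))))
    (mul (div (const 1) (add (codeBit b i (add (const 2) s)) (const 1))) (codeBit b i s))

/-- The truth value of an inequality. -/
def le (e f : Expr) : Expr := div (const 1) (add (div e (add f (const 1))) (const 1))

/-- The decoder. -/
def decoder : Expr :=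
  mul (le (field false 1) (field true 1))
    (add
      (mul (le (field false 2) (field true 2))
        (lookup true (field false 2) (field false 3) (field false 4)))
      (mul (div (const 1) (add (le (field false 2) (field true 2)) (const 1)))
        (lookup false (field true 2) (field true 3) (field true 4))))

/-- The quotient `e / (f + 1)` vanishes exactly when `e ≤ f`, and `1 / (z + 1)` is the indicator of
`z = 0`. -/
theorem eval_le (x y : List Bool) (e f : Expr) :
    (le e f).eval x y = if e.eval x y ≤ f.eval x y then 1 else 0 := by
  simp only [le, eval]
  split_ifs with h
  · rw [Nat.div_eq_of_lt (a := e.eval x y) (by omega)]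
  · have : 1 ≤ e.eval x y / (f.eval x y + 1) := (Nat.one_le_div_iff (by omega)).mpr (by omega)
    exact Nat.div_eq_of_lt (by omega)

/-! ### Values of the parts of the decoder -/

section Values

variable {x y : List Bool} {b : Bool} {D : LabelData}

theorem eval_lead (hD : (if b then y else x) = D.label) : (lead b).eval x y = 2 ^ D.k := by
  rw [eval, hD, D.leadingPow_label]

theorem eval_field (hD : (if b then y else x) = D.label) {j v : ℕ} (hj : D.fields[j]? = some v)
    (hv : v < 2 ^ 2 ^ D.k) : (field b (j + 1)).eval x y = v := by
  rw [field, eval, eval, eval_lead hD, hD, eval, D.bitsAt_field hj hv]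

theorem eval_side (hD : (if b then y else x) = D.label) : (field b 3).eval x y = D.side.toNat :=
  eval_field hD (j := 2) (by simp [LabelData.fields])
    ((Bool.toNat_lt _).trans_le (by
      calc 2 = 2 ^ 1 := rfl
        _ ≤ _ := Nat.pow_le_pow_right (by norm_num) Nat.one_le_two_pow))

variable (hv : D.Valid) (hD : (if b then y else x) = D.label)
include hv hD

theorem eval_rank : (field b 1).eval x y = D.rank :=
  eval_field hD (j := 0) (by simp [LabelData.fields]) hv.rank_lt

theorem eval_grp : (field b 2).eval x y = D.grp :=
  eval_field hD (j := 1) (by simp [LabelData.fields]) hv.grp_lt'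

theorem eval_pos : (field b 4).eval x y = D.pos :=
  eval_field hD (j := 3) (by simp [LabelData.fields]) (hv.pos_lt.trans hv.t_lt)

theorem eval_t : (field b 5).eval x y = D.t :=
  eval_field hD (j := 4) (by simp [LabelData.fields]) hv.t_lt

theorem eval_width : (field b 6).eval x y = 2 * D.k :=
  eval_field hD (j := 5) (by simp [LabelData.fields]) (hv.width_le.trans_lt Nat.lt_two_pow_self)

theorem eval_pointerPos : (field b 7).eval x y = D.pointerPos :=
  eval_field hD (j := 6) (by simp [LabelData.fields]) (by
    have := hv.codePos_add_start_lt
    rw [LabelData.codePos] at this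
    omega)

theorem eval_codePos : (field b 8).eval x y = D.codePos :=
  eval_field hD (j := 7) (by simp [LabelData.fields]) (by
    have := hv.codePos_add_start_lt
    omega)

theorem eval_codeStart {i : Expr} (hi : i.eval x y ≤ D.grp) :
    (codeStart b i).eval x y = D.codePos + D.start (i.eval x y) := by
  set j := i.eval x y with hj
  have h0 : 0 < 2 ^ D.k := by positivity
  have h1 : j / 2 ^ D.k < D.grp / 2 ^ D.k + 1 := Nat.lt_succ_of_le (Nat.div_le_div_right hi)
  have hs : D.start (j / 2 ^ D.k * 2 ^ D.k) ≤ D.start j := D.start_mono (Nat.div_mul_le_self _ _)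
  have hs' : D.start j ≤ D.start (D.grp + 1) := D.start_mono (by omega)
  have hlt := hv.codePos_add_start_lt
  -- Eight fields precede the absolute pointers, and the unary prefix occupies one more slot; hence
  -- the 9 in `codeStart`.
  have h2 : D.fields[8 + j / 2 ^ D.k]? = some (D.start (j / 2 ^ D.k * 2 ^ D.k)) := by
    rw [LabelData.fields, List.getElem?_append_right (by simp)]
    simp [h1]
  have h3 : D.pointers[j]? = some (D.start j - D.start (j / 2 ^ D.k * 2 ^ D.k)) := by
    rw [LabelData.pointers]
    simp [Nat.lt_succ_of_le hi]
  have h4 := D.bitsAt_field h2 (by omega)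
  have h5 := D.bitsAt_pointer h3 (hv.pointer_lt j)
  have e : 9 * 2 ^ D.k + j / 2 ^ D.k * 2 ^ D.k = (8 + j / 2 ^ D.k + 1) * 2 ^ D.k := by ring
  have e6 := eval_width hv hD
  have e7 := eval_pointerPos hv hD
  have e8 := eval_codePos hv hD
  simp only [codeStart, eval.eq_2, eval.eq_3, eval.eq_4, eval.eq_6, eval.eq_1, e6, e7, e8,
    eval_lead hD, hD, ← hj, e, h4, h5]
  omega

theorem eval_codeBit {i o : Expr} (hi : i.eval x y ≤ D.grp)
    (ho : o.eval x y < (D.code (i.eval x y)).length) :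
    (codeBit b i o).eval x y = ((D.code (i.eval x y)).getD (o.eval x y) false).toNat := by
  rw [codeBit, eval, eval, eval, hD, eval_codeStart hv hD hi, D.bitsAt_code hi ho]

theorem eval_lookup {i s p : Expr} {σ : Bool} (hi : i.eval x y ≤ D.grp)
    (hs : s.eval x y = σ.toNat) (hp : p.eval x y < D.t) :
    (lookup b i s p).eval x y = (D.value (i.eval x y) σ (p.eval x y)).toNat := by
  have h0 : 4 ≤ (D.code (i.eval x y)).length := by rw [D.length_code]; omega
  have h1 : (codeBit b i (const 2)).eval x y = (D.explicit (i.eval x y) false).toNat := by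
    rw [eval_codeBit hv hD hi (by simp only [eval]; omega)]
    simp [LabelData.code, eval]
  have h2 : (codeBit b i (add (const 2) s)).eval x y = (D.explicit (i.eval x y) σ).toNat := by
    have := Bool.toNat_lt σ
    rw [eval_codeBit hv hD hi (by simp only [eval, hs]; omega)]
    cases σ <;> simp [LabelData.code, eval, hs]
  have h3 : (codeBit b i s).eval x y = (D.default (i.eval x y) σ).toNat := by
    have := Bool.toNat_lt σ
    rw [eval_codeBit hv hD hi (by simp only [hs]; omega)]
    cases σ <;> simp [LabelData.code, hs]
  -- Bits of side `true` come after those of side `false`, if the latter are present. For a side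
  -- that is not explicit the bit read here is meaningless, but it gets multiplied by zero.
  have h4 : D.explicit (i.eval x y) σ = true →
      (codeBit b i (add (const 4) (add (mul s (mul (codeBit b i (const 2)) (field b 5))) p))).eval x y
        = (D.bit (i.eval x y) σ (p.eval x y)).toNat := by
    intro hσ
    have ev : (add (const 4) (add (mul s (mul (codeBit b i (const 2)) (field b 5))) p)).eval x y =
        4 + (σ.toNat * ((D.explicit (i.eval x y) false).toNat * D.t) + p.eval x y) := by
      simp only [eval.eq_1, eval.eq_2, eval.eq_3, h1, hs, eval_t hv hD]
    rw [eval_codeBit hv hD hi, ev]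
    · have hg := fun s => getD_ofFn (fun p => D.bit (i.eval x y) s p) hp
      cases σ
      · rw [LabelData.code, List.append_assoc, List.getD_append_right _ _ _ _ (by simp)]
        simp only [hσ, if_true, Bool.toNat_false, zero_mul, zero_add, List.length_cons,
          List.length_nil, Nat.add_sub_cancel_left]
        rw [List.getD_append _ _ _ _ (by simpa using hp), hg]
      · rw [LabelData.code, List.getD_append_right]
        · simp only [hσ, if_true]
          cases D.explicit (i.eval x y) false
          · simp [-List.getD_eq_getElem?_getD, hg]
          · have : 4 + (D.t + p.eval x y) - (D.t + 4) = p.eval x y := by omega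
            simp [-List.getD_eq_getElem?_getD, hg, this]
        · cases D.explicit (i.eval x y) false <;> simp
          omega
    · rw [ev, D.length_code]
      cases σ
      · simp only [hσ, Bool.toNat_false, Bool.toNat_true, zero_mul, zero_add]
        nlinarith
      · cases D.explicit (i.eval x y) false <;> simp [hσ] <;> nlinarith
  rw [lookup, eval, eval, eval, eval, eval, eval, eval, h2, h3, LabelData.value]
  cases hσ : D.explicit (i.eval x y) σ
  · simp
  · rw [h4 hσ]; simp

end Values

/-- A label describes only groups up to its own, so the label with the larger group number is asked
about the other node. -/
theorem eval_decoder {D D' : LabelData} (h : D.Valid) (h' : D'.Valid) (ht : D.t = D'.t) :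
    decoder.eval D.label D'.label ≠ 0 ↔ D.rank ≤ D'.rank ∧
      (if D.grp ≤ D'.grp then D'.value D.grp D.side D.pos else D.value D'.grp D'.side D'.pos) =
        true := by
  have e : (if false then D'.label else D.label) = D.label := rfl
  have e' : (if true then D'.label else D.label) = D'.label := rfl
  have g := eval_grp h e
  have g' := eval_grp h' e'
  rw [decoder]
  simp only [eval.eq_1, eval.eq_2, eval.eq_3, eval.eq_4, eval_le, eval_rank h e, eval_rank h' e',
    g, g']
  by_cases hr : D.rank ≤ D'.rank
  · by_cases hg : D.grp ≤ D'.grp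
    · have h1 := eval_lookup h' e' (i := field false 2) (s := field false 3) (p := field false 4)
        (g.trans_le hg) (eval_side e) ((eval_pos h e).trans_lt (ht ▸ h.pos_lt))
      rw [h1, g, eval_pos h e]
      simp [hr, hg]
    · have h1 := eval_lookup h e (i := field true 2) (s := field true 3) (p := field true 4)
        (g'.trans_le (by omega)) (eval_side e') ((eval_pos h' e').trans_lt (ht ▸ h'.pos_lt))
      rw [h1, g', eval_pos h' e']
      simp [hr, hg]
  · simp [hr]

/-! ### Absence of overflow -/

/-- `e` fits into words of length `w` and its value has at most `a` binary digits. -/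
def FitsIn (w : ℕ) (x y : List Bool) (e : Expr) (a : ℕ) : Prop :=
  e.Fits w x y ∧ e.eval x y < 2 ^ a

namespace FitsIn

variable {w : ℕ} {x y : List Bool} {e f : Expr} {a c : ℕ}

theorem mono (h : FitsIn w x y e a) (hac : a ≤ c) : FitsIn w x y e c :=
  ⟨h.1, h.2.trans_le (Nat.pow_le_pow_right (by norm_num) hac)⟩

theorem const {v : ℕ} (hv : v < 2 ^ a) (ha : a ≤ w) : FitsIn w x y (.const v) a :=
  ⟨hv.trans_le (Nat.pow_le_pow_right (by norm_num) ha), hv⟩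

theorem add (he : FitsIn w x y e a) (hf : FitsIn w x y f a) (ha : a + 1 ≤ w) :
    FitsIn w x y (.add e f) (a + 1) := by
  have : e.eval x y + f.eval x y < 2 ^ (a + 1) := by
    have := he.2; have := hf.2; rw [pow_succ]; omega
  exact ⟨⟨he.1, hf.1, this.trans_le (Nat.pow_le_pow_right (by norm_num) ha)⟩, this⟩

theorem mul (he : FitsIn w x y e a) (hf : FitsIn w x y f c) (ha : a + c ≤ w) :
    FitsIn w x y (.mul e f) (a + c) := by
  have : e.eval x y * f.eval x y < 2 ^ (a + c) := by
    rw [pow_add]; exact Nat.mul_lt_mul'' he.2 hf.2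
  exact ⟨⟨he.1, hf.1, this.trans_le (Nat.pow_le_pow_right (by norm_num) ha)⟩, this⟩

theorem div (he : FitsIn w x y e a) (hf : FitsIn w x y f c) : FitsIn w x y (.div e f) a :=
  ⟨⟨he.1, hf.1⟩, (Nat.div_le_self _ _).trans_lt he.2⟩

theorem bits {b : Bool} (he : FitsIn w x y e a) (hf : FitsIn w x y f c) (hw : f.eval x y ≤ w) :
    FitsIn w x y (.bits b e f) (f.eval x y) :=
  ⟨⟨he.1, hf.1, hw⟩, bitsAt_lt _ _ _⟩

end FitsIn

section Fits

variable {w : ℕ} {x y : List Bool} {b : Bool} {D : LabelData}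
theorem fitsIn_lead (hD : (if b then y else x) = D.label) (hw : 4 * 2 ^ D.k ≤ w) :
    FitsIn w x y (lead b) (2 ^ D.k) := by
  have hk : D.k < 2 ^ D.k := Nat.lt_two_pow_self
  refine ⟨⟨?_, ?_⟩, ?_⟩
  · rw [hD]; exact D.idxOf_lt_length
  · rw [hD, D.idxOf_label]; omega
  · rw [eval_lead hD]; exact Nat.lt_two_pow_self

variable (hv : D.Valid) (hD : (if b then y else x) = D.label) (hw : 4 * 2 ^ D.k ≤ w)
include hv hD hw

theorem fitsIn_field {j : ℕ} (hj : j < 16) : FitsIn w x y (field b j) (2 ^ D.k) := by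
  have hL := hv.le_width
  have h := fitsIn_lead hD hw
  have h1 := FitsIn.bits (b := b) ((FitsIn.const (a := 4) (v := j) (by omega) (by omega)).mul h
    (by omega)) h (by rw [eval_lead hD]; omega)
  rwa [eval_lead hD] at h1

theorem fitsIn_codeStart {i : Expr} (hi : FitsIn w x y i (2 ^ D.k)) :
    FitsIn w x y (codeStart b i) (2 ^ D.k + 2) := by
  have hL := hv.le_width
  have h := fitsIn_lead hD hw
  have hf : ∀ j < 16, FitsIn w x y (field b j) (2 ^ D.k) := fun j hj => fitsIn_field hv hD hw hj
  have h1 : FitsIn w x y (add (mul (const 9) (lead b)) (mul (div i (lead b)) (lead b))) _ :=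
    ((FitsIn.const (a := 2 ^ D.k) (v := 9) ((by omega : 9 < 2 ^ D.k).trans Nat.lt_two_pow_self)
      (by omega)).mul h (by omega)).add ((hi.div h).mul h (by omega)) (by omega)
  have h2 := FitsIn.bits (b := b) h1 h (by rw [eval_lead hD]; omega)
  have h3 : FitsIn w x y (add (field b 7) (mul i (field b 6))) _ :=
    ((hf 7 (by omega)).mono (c := 2 ^ D.k + 2 ^ D.k) (by omega)).add
      (hi.mul (hf 6 (by omega)) (by omega)) (by omega)
  have h4 := FitsIn.bits (b := b) h3 (hf 6 (by omega))
    (by rw [eval_width hv hD]; have := hv.width_le; omega)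
  rw [eval_lead hD] at h2
  rw [eval_width hv hD] at h4
  have h5 := (h2.add (h4.mono hv.width_le) (by omega))
  exact ((hf 8 (by omega)).mono (Nat.le_succ _)).add h5 (by omega)

theorem fitsIn_codeBit {i o : Expr} (hi : FitsIn w x y i (2 ^ D.k))
    (ho : FitsIn w x y o (2 * 2 ^ D.k + 8)) : FitsIn w x y (codeBit b i o) 1 := by
  have hL := hv.le_width
  have h := (fitsIn_codeStart hv hD hw hi).mono (c := 2 * 2 ^ D.k + 8) (by omega)
  exact FitsIn.bits (b := b) (h.add ho (by omega)) (FitsIn.const (a := 1) (v := 1) (by norm_num)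
    (by omega)) (by simp only [eval]; omega)

theorem fitsIn_lookup {i s p : Expr} (hi : FitsIn w x y i (2 ^ D.k))
    (hs : FitsIn w x y s (2 ^ D.k)) (hp : FitsIn w x y p (2 ^ D.k)) :
    FitsIn w x y (lookup b i s p) 3 := by
  have hL := hv.le_width
  have hc : ∀ v ≤ 4, FitsIn w x y (const v) (2 ^ D.k) := fun v hv =>
    FitsIn.const ((by omega : v < 2 ^ D.k).trans Nat.lt_two_pow_self) (by omega)
  have hb : ∀ o, FitsIn w x y o (2 ^ D.k + 1) → FitsIn w x y (codeBit b i o) 1 := fun o ho =>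
    fitsIn_codeBit hv hD hw hi (ho.mono (by omega))
  have h2 := hb _ ((hc 2 (by omega)).add hs (by omega))
  have h3 := hb _ (hs.mono (by omega))
  have h4 := hb _ ((hc 2 (by omega)).mono (by omega))
  have h5 : FitsIn w x y (add (const 4) (add (mul s (mul (codeBit b i (const 2)) (field b 5))) p)) _ :=
    ((hc 4 (by omega)).mono (c := 2 ^ D.k + (1 + 2 ^ D.k) + 1) (by omega)).add
    ((hs.mul (h4.mul (fitsIn_field hv hD hw (j := 5) (by omega)) (by omega)) (by omega)).add
      (hp.mono (by omega)) (by omega)) (by omega)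
  have h6 := fitsIn_codeBit hv hD hw hi (h5.mono (by omega))
  have h1 : FitsIn w x y (const 1) 1 := FitsIn.const (by norm_num) (by omega)
  exact (h2.mul h6 (by omega)).add ((h1.div (h2.add h1 (by omega))).mul h3 (by omega)) (by omega)

end Fits

theorem FitsIn.le {w : ℕ} {x y : List Bool} {e f : Expr} {a : ℕ} (he : FitsIn w x y e a)
    (hf : FitsIn w x y f a) (h1 : 1 ≤ a) (ha : a + 2 ≤ w) : FitsIn w x y (le e f) 1 := by
  have hc : FitsIn w x y (Expr.const 1) 1 := FitsIn.const (by norm_num) (by omega)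
  exact hc.div ((he.div (hf.add (hc.mono h1) (by omega))).add (hc.mono h1) (by omega))

/-- The largest intermediate results are bit positions. Built from products of two numbers of at
most `2 ^ k` digits, they have `2 * 2 ^ k + O(1)` digits, and `2 ^ k ≥ 16` absorbs the constant. -/
theorem fits_decoder {w : ℕ} {D D' : LabelData} (h : D.Valid) (h' : D'.Valid) (hk : D.k = D'.k)
    (hw : 4 * 2 ^ D.k ≤ w) : decoder.Fits w D.label D'.label := by
  have hL := h.le_width
  have e : (if false then D'.label else D.label) = D.label := rfl
  have e' : (if true then D'.label else D.label) = D'.label := rfl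
  have hf : ∀ j < 16, FitsIn w D.label D'.label (field false j) (2 ^ D.k) := fun j hj =>
    fitsIn_field h e hw hj
  have hf' : ∀ j < 16, FitsIn w D.label D'.label (field true j) (2 ^ D.k) := fun j hj =>
    hk ▸ fitsIn_field h' e' (hk ▸ hw) hj
  have h1 := fitsIn_lookup h e hw (hf' 2 (by omega)) (hf' 3 (by omega)) (hf' 4 (by omega))
  have h2 := fitsIn_lookup h' e' (hk ▸ hw) (hk ▸ hf 2 (by omega)) (hk ▸ hf 3 (by omega))
    (hk ▸ hf 4 (by omega))
  have h3 := (hf 1 (by omega)).le (hf' 1 (by omega)) (by omega) (by omega)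
  have h4 := (hf 2 (by omega)).le (hf' 2 (by omega)) (by omega) (by omega)
  have hc : FitsIn w D.label D'.label (const 1) 1 := FitsIn.const (by norm_num) (by omega)
  exact (h3.mul ((h4.mul h2 (by omega)).add ((hc.div (h4.add hc (by omega))).mul h1 (by omega))
    (by omega)) (by omega)).1

end WordRAM.Expr

theorem LabelData.label_ne {D D' : LabelData} (h : D.Valid) (h' : D'.Valid)
    (hne : D.grp ≠ D'.grp ∨ D.side ≠ D'.side ∨ D.pos ≠ D'.pos) : D.label ≠ D'.label := by
  intro he
  have e : (if false then D.label else D.label) = D.label := rfl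
  have e' : (if false then D.label else D.label) = D'.label := he
  have h1 := WordRAM.Expr.eval_grp h e
  have h2 := WordRAM.Expr.eval_side e
  have h3 := WordRAM.Expr.eval_pos h e
  rw [WordRAM.Expr.eval_grp h' e'] at h1
  rw [WordRAM.Expr.eval_side e'] at h2
  rw [WordRAM.Expr.eval_pos h' e'] at h3
  have h4 : D'.side = D.side := by
    revert h2
    cases D.side <;> cases D'.side <;> simp
  rcases hne with h | h | h
  · exact h h1.symm
  · exact h h4.symm
  · exact h h3.symm

/-! ### Grouping the elements of an ordered set -/

section Grouping

open Finset

variable {V : Type*}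

/-- Some elements of `X` are related to `w` and some are not. -/
def Mixed (T : V → V → Prop) (w : V) (X : Finset V) : Prop :=
  (∃ x ∈ X, T w x) ∧ ∃ x ∈ X, ¬ T w x

theorem Mixed.mono {T : V → V → Prop} {w : V} {X Y : Finset V} (h : Mixed T w X) (hXY : X ⊆ Y) :
    Mixed T w Y :=
  ⟨h.1.imp fun _ hx => ⟨hXY hx.1, hx.2⟩, h.2.imp fun _ hx => ⟨hXY hx.1, hx.2⟩⟩

/-- `I` divides the elements into consecutive classes, and the symmetric relation `T` is
transitive along increasing sequences of classes. -/
structure IsLayered (T : V → V → Prop) (I : V → ℕ) : Prop where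
  symm : ∀ u v, T u v → T v u
  trans : ∀ u v z, I u < I v → I v < I z → T u v → T v z → T u z

/-- If all elements of `X` are related to all elements of `Y` and `X` and `Y` lie in two different
classes, then only elements of these classes and of those between them are mixed to both. -/
theorem IsLayered.class_of_mixed {T : V → V → Prop} {I : V → ℕ} (h : IsLayered T I)
    {X Y : Finset V} {a c : ℕ} (hX : ∀ x ∈ X, I x = a) (hY : ∀ y ∈ Y, I y = c) (hac : a ≠ c)
    (hXY : ∀ x ∈ X, ∀ y ∈ Y, T x y) {w : V} (hwX : Mixed T w X) (hwY : Mixed T w Y) :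
    I w = a ∨ I w = c ∨ (a < I w ∧ I w < c) ∨ (c < I w ∧ I w < a) := by
  by_contra hcon
  obtain ⟨⟨x, hx, hwx⟩, ⟨x', hx', hwx'⟩⟩ := hwX
  obtain ⟨⟨y, hy, hwy⟩, ⟨y', hy', hwy'⟩⟩ := hwY
  have e1 := hX x hx
  have e2 := hX x' hx'
  have e3 := hY y hy
  have e4 := hY y' hy'
  have hx'y := hXY x' hx' y hy
  have hxy' := hXY x hx y' hy'
  -- If `w` lay before or after both classes, its link to one element of the nearer set would pass
  -- through that element to all of the farther set.
  rcases lt_or_gt_of_ne hac with hlt | hlt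
  · by_cases h1 : I w < a
    · exact hwy' (h.trans w x y' (by omega) (by omega) hwx hxy')
    · exact hwx' (h.symm _ _ (h.trans x' y w (by omega) (by omega) hx'y (h.symm _ _ hwy)))
  · by_cases h1 : I w < c
    · exact hwx' (h.trans w y x' (by omega) (by omega) hwy (h.symm _ _ hx'y))
    · exact hwy' (h.symm _ _ (h.trans y' x w (by omega) (by omega) (h.symm _ _ hxy')
        (h.symm _ _ hwx)))

variable [DecidableEq V]

open Classical in
/-- Among `B` blocks of `t` elements of `X` there is one that is met by few of the neighborhoods. -/
theorem exists_block_few_neighbors (T : V → V → Prop) {X W : Finset V} {t B d : ℕ}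
    (hB : 0 < B) (hX : #X = t * B) (hd : ∀ w ∈ W, #{x ∈ X | T w x} ≤ d) :
    ∃ X' ⊆ X, #X' = t ∧ #{w ∈ W | ∃ x ∈ X', T w x} * B ≤ #W * d := by
  have hcard : Fintype.card X = Fintype.card (Fin B × Fin t) := by simp [hX, mul_comm]
  let φ : X ≃ Fin B × Fin t := Fintype.equivOfCardEq hcard
  let blk : Fin B → Finset V := fun j => univ.image fun i : Fin t => ((φ.symm (j, i) : X) : V)
  have hblk : ∀ j, #(blk j) = t := fun j => by
    rw [card_image_of_injective]
    · simp
    · intro a b hab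
      simpa using φ.symm.injective (Subtype.ext hab)
  have hsub : ∀ j, blk j ⊆ X := fun j x hx => by
    obtain ⟨i, -, rfl⟩ := mem_image.mp hx
    exact (φ.symm (j, i)).2
  have hdisj : ∀ x ∈ X, ∀ i j, x ∈ blk i → x ∈ blk j → i = j := by
    intro x _ i j hi hj
    obtain ⟨a, -, ha⟩ := mem_image.mp hi
    obtain ⟨b, -, hb⟩ := mem_image.mp hj
    have := φ.symm.injective (Subtype.ext (ha.trans hb.symm))
    exact (Prod.mk.inj this).1
  -- Double counting: the blocks are disjoint, so an element of `W` meets at most as many blocks as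
  -- it has neighbours in `X`. The best of the `B` blocks is then no worse than the average.
  have hsum : ∑ j, #{w ∈ W | ∃ x ∈ blk j, T w x} ≤ #W * d := by
    calc ∑ j, #{w ∈ W | ∃ x ∈ blk j, T w x}
        = ∑ w ∈ W, #{j : Fin B | ∃ x ∈ blk j, T w x} := by
          simp only [card_filter]
          exact sum_comm
      _ ≤ ∑ _w ∈ W, d := sum_le_sum fun w hw => by
          refine le_trans ?_ (hd w hw)
          have hch : ∀ j : Fin B, (∃ x ∈ blk j, T w x) → ∃ x, x ∈ blk j ∧ T w x := fun _ h => h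
          have : Nonempty V := ⟨w⟩
          choose! f hf using hch
          refine card_le_card_of_injOn f (fun j hj => ?_) fun i hi j hj hij => ?_
          · have hj' := hf j (by simpa using hj)
            simpa using ⟨hsub j hj'.1, hj'.2⟩
          · have hi' := hf i (by simpa using hi)
            have hj' := hf j (by simpa using hj)
            exact hdisj (f i) (hsub i hi'.1) i j hi'.1 (hij ▸ hj'.1)
      _ = #W * d := by rw [sum_const, smul_eq_mul]
  have : Nonempty (Fin B) := ⟨⟨0, hB⟩⟩
  obtain ⟨j, -, hj⟩ := exists_min_image univ (fun j => #{w ∈ W | ∃ x ∈ blk j, T w x})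
    univ_nonempty
  refine ⟨blk j, hsub j, hblk j, le_trans ?_ hsum⟩
  have := card_nsmul_le_sum univ (fun j => #{w ∈ W | ∃ x ∈ blk j, T w x}) _ (fun i hi => hj i hi)
  simpa [mul_comm] using this

open Classical in
/-- Greedy division of a set into pairs of sets of `t` elements. -/
theorem exists_greedy_grouping (T : V → V → Prop) {t h e : ℕ} (ht : 0 < t)
    (hpair : ∀ R : Finset V, h < #R → ∃ X Y : Finset V, X ⊆ R ∧ Y ⊆ R ∧ #X = t ∧ #Y = t ∧
      Disjoint X Y ∧ #{w ∈ R | Mixed T w X ∧ Mixed T w Y} ≤ e) (R : Finset V) :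
    ∃ (K : ℕ) (g : V → ℕ) (s : V → Bool),
      (∀ i < K, ∀ b, #{v ∈ R | g v = i ∧ s v = b} = t) ∧
      (∀ i < K, #{w ∈ R | i ≤ g w ∧ Mixed T w {v ∈ R | g v = i ∧ s v = false} ∧
        Mixed T w {v ∈ R | g v = i ∧ s v = true}} ≤ e) ∧
      #{w ∈ R | K ≤ g w} ≤ h := by
  induction hn : #R using Nat.strong_induction_on generalizing R with
  | _ n ih =>
  by_cases hR : h < #R
  · obtain ⟨X, Y, hXR, hYR, hX, hY, hXY, hXYe⟩ := hpair R hR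
    set R' := R \ (X ∪ Y) with hR'
    have hlt : #R' < n := by
      rw [← hn]
      refine card_lt_card (_root_.ssubset_iff_subset_ne.mpr ⟨sdiff_subset, fun heq => ?_⟩)
      obtain ⟨x, hx⟩ := card_pos.mp (hX ▸ ht)
      have : x ∈ R' := heq ▸ hXR hx
      exact (mem_sdiff.mp this).2 (mem_union_left _ hx)
    obtain ⟨K, g, s, h1, h2, h3⟩ := ih _ hlt R' rfl
    -- The pair found first becomes group 0: its bound covers all of `R`, hence all later groups.
    let g' : V → ℕ := fun v => if v ∈ X ∪ Y then 0 else g v + 1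
    let s' : V → Bool := fun v => if v ∈ X then false else if v ∈ Y then true else s v
    have c0 : ({v ∈ R | g' v = 0 ∧ s' v = false} : Finset V) = X := by
      ext v
      have hd : v ∈ X → v ∉ Y := fun hv => Finset.disjoint_left.mp hXY hv
      simp only [mem_filter, g', s', mem_union]
      by_cases hvX : v ∈ X
      · simp [hvX, hXR hvX]
      · by_cases hvY : v ∈ Y <;> simp [hvX, hvY]
    have c1 : ({v ∈ R | g' v = 0 ∧ s' v = true} : Finset V) = Y := by
      ext v
      have hd : v ∈ X → v ∉ Y := fun hv => Finset.disjoint_left.mp hXY hv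
      simp only [mem_filter, g', s', mem_union]
      by_cases hvX : v ∈ X
      · simp [hvX, hd hvX]
      · by_cases hvY : v ∈ Y
        · simp [hvX, hvY, hYR hvY]
        · simp [hvX, hvY]
    have cs : ∀ i b, ({v ∈ R | g' v = i + 1 ∧ s' v = b} : Finset V) =
        {v ∈ R' | g v = i ∧ s v = b} := by
      intro i b
      ext v
      simp only [mem_filter, g', s', hR', mem_sdiff, mem_union]
      by_cases hvX : v ∈ X
      · simp [hvX]
      · by_cases hvY : v ∈ Y <;> simp [hvX, hvY]
    refine ⟨K + 1, g', s', ?_, ?_, ?_⟩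
    · rintro (_ | i) hi b
      · cases b
        · rw [c0, hX]
        · rw [c1, hY]
      · rw [cs]; exact h1 i (by omega) b
    · rintro (_ | i) hi
      · rw [c0, c1]
        simpa using hXYe
      · rw [cs, cs]
        refine le_trans (card_le_card fun w hw => ?_) (h2 i (by omega))
        simp only [mem_filter] at hw ⊢
        obtain ⟨hwR, hwi, hw2⟩ := hw
        have hwn : w ∉ X ∪ Y := fun hc => by
          simp only [g', hc, if_true] at hwi
          omega
        simp only [g', hwn, if_false] at hwi
        exact ⟨mem_sdiff.mpr ⟨hwR, hwn⟩, by omega, hw2⟩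
    · refine le_trans (card_le_card fun w hw => ?_) h3
      obtain ⟨hwR, hwi⟩ := mem_filter.mp hw
      have hwn : w ∉ X ∪ Y := fun hc => by
        simp only [g', hc, if_true] at hwi
        omega
      simp only [g', hwn, if_false] at hwi
      exact mem_filter.mpr ⟨mem_sdiff.mpr ⟨hwR, hwn⟩, by omega⟩
  · refine ⟨0, fun _ => 0, fun _ => false, by simp, by simp, ?_⟩
    simpa using (not_lt.mp hR)

variable [Fintype V]

-- Induction on the distance `m` from class `a` within which elements outside `J` may still be mixed
-- to both sets. Call those with at least `t * M ^ m` neighbours in `X` heavy. If few are heavy,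
-- some `t` elements of `X` are avoided by nearly all others. If many are, pigeonhole yields `X''`
-- and `Y''` completely related, and `class_of_mixed` leaves, apart from the two classes forming the
-- new `J`, only those strictly between, at distance at most `m` from `a`. The hypothesis `hex`
-- speaks of all subsets of `X` because the first case shrinks `X`.
open Classical in
theorem IsLayered.exists_pair_aux {T : V → V → Prop} {I : V → ℕ} (hT : IsLayered T I)
    {Q l t M h : ℕ} (hQ : ∀ v, I v < Q) (hl : ∀ a, #{v | I v = a} ≤ l) (ht : 0 < t) (hM : 0 < M)
    (hh : Fintype.card V * t ≤ h * M) (hbig : Q * 2 ^ (t * M ^ Q) * t ≤ h) (R : Finset V)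
    (m : ℕ) (hm : m ≤ Q) (a : ℕ) (X Y : Finset V) (hXR : X ⊆ R) (hXa : ∀ x ∈ X, I x = a)
    (hX : #X = t * M ^ m) (hYR : Y ⊆ R) (hY : #Y = t) (hXY : Disjoint X Y)
    (J : Finset V) (hJ : #J ≤ 2 * l)
    (hex : ∀ X' ⊆ X, ∀ w, Mixed T w X' → Mixed T w Y →
      w ∈ J ∨ (I w ≠ a ∧ I w ≤ a + m ∧ a ≤ I w + m)) :
    ∃ X' Y' : Finset V, X' ⊆ R ∧ Y' ⊆ R ∧ #X' = t ∧ #Y' = t ∧ Disjoint X' Y' ∧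
      #{w ∈ R | Mixed T w X' ∧ Mixed T w Y'} ≤ 2 * l + 2 * h := by
  induction m generalizing a X Y J with
  | zero =>
    refine ⟨X, Y, hXR, hYR, by simpa using hX, hY, hXY, ?_⟩
    refine (card_le_card (t := J) fun w hw => ?_).trans (by omega)
    obtain ⟨-, h1, h2⟩ := mem_filter.mp hw
    rcases hex X subset_rfl w h1 h2 with h3 | h3
    · exact h3
    · omega
  | succ m ih =>
    set W : Finset V := {w ∈ R | I w ≠ a ∧ I w ≤ a + (m + 1) ∧ a ≤ I w + (m + 1)} with hW
    set H : Finset V := {w ∈ W | t * M ^ m ≤ #{x ∈ X | T w x}} with hH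
    by_cases hcase : #H ≤ h
    · obtain ⟨X', hX'X, hX', hfew⟩ := exists_block_few_neighbors T (W := W \ H) (X := X) (t := t)
        (B := M ^ (m + 1)) (d := t * M ^ m) (by positivity) hX (fun w hw => by
          have hw' := mem_sdiff.mp hw
          have : ¬ t * M ^ m ≤ #{x ∈ X | T w x} := fun hc => hw'.2 (mem_filter.mpr ⟨hw'.1, hc⟩)
          omega)
      refine ⟨X', Y, hX'X.trans hXR, hYR, hX', hY, hXY.mono_left hX'X, ?_⟩
      -- A light element has fewer than `t * M ^ m` neighbours, and there are `M ^ (m + 1)` blocks,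
      -- so the average is at most `card V * t / M ≤ h`.
      have h1 : #{w ∈ W \ H | ∃ x ∈ X', T w x} ≤ h := by
        have h2 : #{w ∈ W \ H | ∃ x ∈ X', T w x} * M ^ (m + 1) ≤ h * M ^ (m + 1) :=
          calc _ ≤ _ := hfew
            _ ≤ Fintype.card V * (t * M ^ m) := Nat.mul_le_mul_right _ (card_le_univ _)
            _ = Fintype.card V * t * M ^ m := by ring
            _ ≤ h * M * M ^ m := Nat.mul_le_mul_right _ hh
            _ = _ := by ring
        exact Nat.le_of_mul_le_mul_right h2 (by positivity)
      have hsub : {w ∈ R | Mixed T w X' ∧ Mixed T w Y} ⊆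
          J ∪ (H ∪ {w ∈ W \ H | ∃ x ∈ X', T w x}) := by
        intro w hw
        obtain ⟨hwR, hw1, hw2⟩ := mem_filter.mp hw
        rcases hex X' hX'X w hw1 hw2 with h3 | h3
        · exact mem_union_left _ h3
        · by_cases hwH : w ∈ H
          · exact mem_union_right _ (mem_union_left _ hwH)
          · exact mem_union_right _ (mem_union_right _ (mem_filter.mpr
              ⟨mem_sdiff.mpr ⟨mem_filter.mpr ⟨hwR, h3⟩, hwH⟩, hw1.1⟩))
      have h4 := card_le_card hsub
      have h5 := card_union_le J (H ∪ {w ∈ W \ H | ∃ x ∈ X', T w x})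
      have h6 := card_union_le H {w ∈ W \ H | ∃ x ∈ X', T w x}
      omega
    · have hch : ∀ w ∈ H, ∃ S, S ⊆ ({x ∈ X | T w x} : Finset V) ∧ #S = t * M ^ m := fun w hw =>
        exists_subset_card_eq (mem_filter.mp hw).2
      choose! S hS using hch
      -- The pigeonholes are pairs of a class and a subset of `X`; this is what makes `hbig` doubly
      -- exponential in `Q`.
      have hmaps : ∀ w ∈ H, (I w, S w) ∈ range Q ×ˢ X.powerset := fun w hw => by
        refine mem_product.mpr ⟨mem_range.mpr (hQ w), mem_powerset.mpr ?_⟩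
        exact (hS w hw).1.trans (filter_subset _ _)
      have hlt : #(range Q ×ˢ X.powerset) * t < #H := by
        rw [card_product, card_range, card_powerset, hX]
        calc Q * 2 ^ (t * M ^ (m + 1)) * t ≤ Q * 2 ^ (t * M ^ Q) * t := by
              gcongr
              · norm_num
          _ ≤ h := hbig
          _ < #H := by omega
      obtain ⟨⟨c, X''⟩, -, hfib⟩ := exists_lt_card_fiber_of_mul_lt_card_of_maps_to hmaps hlt
      obtain ⟨Y'', hY''sub, hY''⟩ := exists_subset_card_eq hfib.le
      have hmem : ∀ w ∈ Y'', w ∈ H ∧ I w = c ∧ S w = X'' := fun w hw => by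
        obtain ⟨h1, h2⟩ := mem_filter.mp (hY''sub hw)
        exact ⟨h1, (Prod.mk.inj h2).1, (Prod.mk.inj h2).2⟩
      obtain ⟨w₀, hw₀⟩ : Y''.Nonempty := card_pos.mp (by omega)
      obtain ⟨hw₀H, hw₀c, hw₀S⟩ := hmem w₀ hw₀
      have hX''X : X'' ⊆ X := hw₀S ▸ (hS w₀ hw₀H).1.trans (filter_subset _ _)
      have hHW : ∀ w ∈ H, w ∈ R ∧ (I w ≠ a ∧ I w ≤ a + (m + 1) ∧ a ≤ I w + (m + 1)) := fun w hw =>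
        mem_filter.mp (mem_filter.mp hw).1
      have hc := (hHW w₀ hw₀H).2
      rw [hw₀c] at hc
      refine ih (by omega) a X'' Y'' (hX''X.trans hXR) (fun x hx => hXa x (hX''X hx))
        (hw₀S ▸ (hS w₀ hw₀H).2) (fun w hw => (hHW w (hmem w hw).1).1) hY'' ?_
        (({v | I v = a} : Finset V) ∪ ({v | I v = c} : Finset V)) ?_ ?_
      · refine Finset.disjoint_left.mpr fun v hv hv' => ?_
        have := hXa v (hX''X hv)
        have := (hmem v hv').2.1
        omega
      · have := card_union_le ({v | I v = a} : Finset V) {v | I v = c}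
        have := hl a
        have := hl c
        omega
      · intro X' hX' w hw1 hw2
        have hcomp : ∀ x ∈ X', ∀ y ∈ Y'', T x y := fun x hx y hy => by
          obtain ⟨hyH, -, hyS⟩ := hmem y hy
          have := (hS y hyH).1 (hyS ▸ hX' hx)
          exact hT.symm _ _ (mem_filter.mp this).2
        have := hT.class_of_mixed (fun x hx => hXa x (hX''X (hX' hx)))
          (fun y hy => (hmem y hy).2.1) hc.1.symm hcomp hw1 hw2
        simp only [mem_union, mem_filter, mem_univ, true_and]
        omega

open Classical in
/-- A large set contains two disjoint sets of `t` elements such that few elements are mixed to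
both. -/
theorem IsLayered.exists_pair {T : V → V → Prop} {I : V → ℕ} (hT : IsLayered T I)
    {Q l t M h : ℕ} (hQ : ∀ v, I v < Q) (hl : ∀ a, #{v | I v = a} ≤ l) (ht : 0 < t) (hM : 0 < M)
    (hh : Fintype.card V * t ≤ h * M) (hbig : Q * 2 ^ (t * M ^ Q) * t ≤ h) (R : Finset V)
    (hR : h < #R) :
    ∃ X Y : Finset V, X ⊆ R ∧ Y ⊆ R ∧ #X = t ∧ #Y = t ∧ Disjoint X Y ∧
      #{w ∈ R | Mixed T w X ∧ Mixed T w Y} ≤ 2 * l + 2 * h := by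
  set s := t * M ^ Q with hs
  have hs1 : s + 1 ≤ 2 ^ s := Nat.lt_two_pow_self
  have hQ0 : 0 < Q := by
    obtain ⟨v, -⟩ := card_pos.mp (by omega : 0 < #R)
    exact (Nat.zero_le _).trans_lt (hQ v)
  have h1 : Q * (s + 1) * t ≤ h := le_trans (by gcongr) hbig
  have h2 : Q * (s + 1) ≤ Q * (s + 1) * t := Nat.le_mul_of_pos_right _ ht
  have h3 : (s + 1) * t ≤ Q * (s + 1) * t := by
    rw [mul_assoc]; exact Nat.le_mul_of_pos_left _ hQ0
  have h4 : t * 1 ≤ s := Nat.mul_le_mul_left _ (Nat.one_le_pow _ _ hM)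
  have h5 : #(range Q) * s < #R := by rw [card_range]; nlinarith
  obtain ⟨a, -, hfib⟩ := exists_lt_card_fiber_of_mul_lt_card_of_maps_to
    (fun v _ => mem_range.mpr (hQ v)) h5
  obtain ⟨X, hXsub, hX⟩ := exists_subset_card_eq hfib.le
  have hXR : X ⊆ R := hXsub.trans (filter_subset _ _)
  have hXa : ∀ x ∈ X, I x = a := fun x hx => (mem_filter.mp (hXsub hx)).2
  have h6 : t ≤ #(R \ X) := by
    rw [card_sdiff_of_subset hXR, hX]
    have : s + t ≤ (s + 1) * t + s := by nlinarith
    have : 1 ≤ s := by omega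
    rcases Nat.lt_or_ge t 2 with h7 | h7
    · have : t = 1 := by omega
      subst this
      omega
    · have : s * 2 ≤ s * t := Nat.mul_le_mul_left _ h7
      rw [add_mul, one_mul] at h3
      omega
  -- The first `Y` is arbitrary: all classes lie within distance `Q`, so nothing is excluded yet.
  obtain ⟨Y, hYsub, hY⟩ := exists_subset_card_eq h6
  refine hT.exists_pair_aux hQ hl ht hM hh hbig R Q le_rfl a X Y hXR hXa hX
    (hYsub.trans sdiff_subset) hY ?_ ({v | I v = a} : Finset V) ?_ ?_
  · exact (disjoint_sdiff.mono_right hYsub)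
  · have := hl a; omega
  · intro X' hX' w hw1 _
    obtain ⟨⟨x, hx, -⟩, -⟩ := hw1
    have e := hXa x (hX' hx)
    have := hQ x
    have := hQ w
    simp only [mem_filter, mem_univ, true_and]
    omega

end Grouping

/-! ### Numbering the groups and isolating exceptional elements -/

section Grouping

open Finset

theorem exists_index {V : Type*} (S : Finset V) :
    ∃ f : V → ℕ, Set.InjOn f S ∧ ∀ v ∈ S, f v < #S := by
  classical
  refine ⟨fun v => if h : v ∈ S then S.equivFin ⟨v, h⟩ else 0, fun u hu v hv huv => ?_,
    fun v hv => ?_⟩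
  · have hu' : u ∈ S := hu
    have hv' : v ∈ S := hv
    simp only [hu', hv', dif_pos] at huv
    simpa using S.equivFin.injective (Fin.ext huv)
  · simp only [hv, dif_pos]
    exact (S.equivFin ⟨v, hv⟩).2

/-- Used to spread consecutively numbered exceptional elements over groups, sides and positions
injectively. -/
theorem eq_of_div_eq_of_mod_eq {a b t : ℕ} (ht : 0 < t) (h1 : a / (2 * t) = b / (2 * t))
    (h2 : t ≤ a % (2 * t) ↔ t ≤ b % (2 * t)) (h3 : a % t = b % t) : a = b := by
  have ha : a % (2 * t) % t = a % t := Nat.mod_mod_of_dvd _ (Dvd.intro_left _ rfl)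
  have hb : b % (2 * t) % t = b % t := Nat.mod_mod_of_dvd _ (Dvd.intro_left _ rfl)
  have ha' := Nat.mod_lt a (by omega : 0 < 2 * t)
  have hb' := Nat.mod_lt b (by omega : 0 < 2 * t)
  have key : a % (2 * t) = b % (2 * t) := by
    rw [← ha, ← hb] at h3
    generalize a % (2 * t) = x at *
    generalize b % (2 * t) = y at *
    by_cases h : t ≤ x
    · have h' := h2.mp h
      rw [Nat.mod_eq_sub_mod h, Nat.mod_eq_sub_mod h', Nat.mod_eq_of_lt (a := x - t) (by omega),
        Nat.mod_eq_of_lt (a := y - t) (by omega)] at h3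
      omega
    · have h' := mt h2.mpr h
      rwa [Nat.mod_eq_of_lt (a := x) (by omega), Nat.mod_eq_of_lt (a := y) (by omega)] at h3
  rw [← Nat.div_add_mod a (2 * t), ← Nat.div_add_mod b (2 * t), h1, key]

variable {V : Type*} [Fintype V] [DecidableEq V]

open Classical in
/-- A division of the elements into groups of two sides with `t` positions each, such that each
element is mixed to both sides of only few of the groups up to its own. -/
theorem exists_grouping_of_greedy (T : V → V → Prop) {t h e K : ℕ} (τ : ℕ) (ht : 0 < t)
    (g : V → ℕ) (s : V → Bool) (h1 : ∀ i < K, ∀ b, #{v | g v = i ∧ s v = b} = t)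
    (h2 : ∀ i < K, #{w | i ≤ g w ∧ Mixed T w {v | g v = i ∧ s v = false} ∧
        Mixed T w {v | g v = i ∧ s v = true}} ≤ e)
    (h3 : #{w | K ≤ g w} ≤ h) :
    ∃ (B : ℕ) (grp pos : V → ℕ) (side : V → Bool),
      Function.Injective (fun v => (grp v, side v, pos v)) ∧ (∀ v, pos v < t) ∧
      2 * t * K ≤ Fintype.card V ∧ B * (τ + 1) ≤ h * (τ + 1) + K * e ∧
      (∀ v, grp v ≤ B / (2 * t) + K) ∧
      ∑ v, grp v ≤ Fintype.card V * (B / (2 * t) + 1) + t * K ^ 2 ∧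
      ∀ v, #{i ∈ range (grp v + 1) | Mixed T v {u | grp u = i ∧ side u = false} ∧
        Mixed T v {u | grp u = i ∧ side u = true}} ≤ B / (2 * t) + 1 + τ := by
  set C : ℕ → Bool → Finset V := fun i b => {v | g v = i ∧ s v = b} with hC
  set cnt : V → ℕ := fun w => #{i ∈ range K | i ≤ g w ∧ Mixed T w (C i false) ∧ Mixed T w (C i true)}
    with hcnt
  set Bad : Finset V := {w | K ≤ g w ∨ τ < cnt w} with hBad
  have hcard : ∀ i < K, #{v | g v = i} = 2 * t := fun i hi => by
    rw [← card_filter_add_card_filter_not (s := ({v | g v = i} : Finset V)) (fun v => s v = false),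
      filter_filter, filter_filter]
    have e1 := h1 i hi false
    have e2 := h1 i hi true
    simp only [Bool.not_eq_false]
    omega
  have hK : 2 * t * K ≤ Fintype.card V := by
    calc 2 * t * K = ∑ i ∈ range K, #{v | g v = i} := by
          rw [sum_congr rfl fun i hi => hcard i (mem_range.mp hi)]
          simp [mul_comm]
      _ = #{v | g v ∈ range K} := by
          rw [card_eq_sum_card_fiberwise (f := g) (t := range K) (fun v hv => by simpa using hv)]
          refine sum_congr rfl fun i hi => ?_
          rw [filter_filter]
          congr 1
          ext v
          simp only [mem_filter, mem_univ, true_and]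
          exact ⟨fun hv => ⟨hv ▸ hi, hv⟩, fun hv => hv.2⟩
      _ ≤ _ := card_le_univ _
  -- Double counting of pairs of an element and a group to both sides of which it is mixed.
  have hBadCard : #Bad * (τ + 1) ≤ h * (τ + 1) + K * e := by
    have hu : #Bad ≤ #{w | K ≤ g w} + #{w | τ < cnt w} := by
      rw [hBad, filter_or]; exact card_union_le _ _
    have hm : #{w | τ < cnt w} * (τ + 1) ≤ K * e := by
      calc #{w | τ < cnt w} * (τ + 1) ≤ ∑ w with τ < cnt w, cnt w := by
            rw [← smul_eq_mul]
            exact card_nsmul_le_sum _ _ _ fun w hw => (mem_filter.mp hw).2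
        _ ≤ ∑ w, cnt w := sum_le_sum_of_subset (filter_subset _ _)
        _ = ∑ i ∈ range K, #{w | i ≤ g w ∧ Mixed T w (C i false) ∧ Mixed T w (C i true)} := by
            simp only [hcnt, card_filter]
            exact sum_comm
        _ ≤ ∑ _i ∈ range K, e := sum_le_sum fun i hi => h2 i (mem_range.mp hi)
        _ = K * e := by simp
    calc #Bad * (τ + 1) ≤ (h + #{w | τ < cnt w}) * (τ + 1) := by gcongr; omega
      _ = h * (τ + 1) + #{w | τ < cnt w} * (τ + 1) := by ring
      _ ≤ _ := by omega
  obtain ⟨β, hβ, hβlt⟩ := exists_index Bad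
  choose f hf hflt using fun i b => exists_index (C i b)
  have hgood : ∀ v ∉ Bad, g v < K ∧ cnt v ≤ τ := fun v hv => by
    simpa [hBad] using hv
  set A := #Bad / (2 * t) with hA
  -- Exceptional elements come first, so they describe at most `A + 1` groups. The other groups are
  -- shifted by `A + 1`; their sides only lose elements, which creates no new mixedness.
  let grp : V → ℕ := fun v => if v ∈ Bad then β v / (2 * t) else A + 1 + g v
  let side : V → Bool := fun v => if v ∈ Bad then decide (t ≤ β v % (2 * t)) else s v
  let pos : V → ℕ := fun v => if v ∈ Bad then β v % t else f (g v) (s v) v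
  have hgrpBad : ∀ v ∈ Bad, grp v ≤ A := fun v hv => by
    simp only [grp, hv, if_true]
    exact Nat.div_le_div_right (hβlt v hv).le
  refine ⟨#Bad, grp, pos, side, ?_, ?_, hK, hBadCard, ?_, ?_, ?_⟩
  · intro u v huv
    simp only [Prod.mk.injEq] at huv
    obtain ⟨e1, e2, e3⟩ := huv
    by_cases hu : u ∈ Bad
    · by_cases hv : v ∈ Bad
      · simp only [grp, side, pos, hu, hv, if_true] at e1 e2 e3
        exact hβ hu hv (eq_of_div_eq_of_mod_eq ht e1 (by simpa using e2) e3)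
      · have := hgrpBad u hu
        rw [e1] at this
        simp only [grp, hv, if_false] at this
        omega
    · by_cases hv : v ∈ Bad
      · have := hgrpBad v hv
        rw [← e1] at this
        simp only [grp, hu, if_false] at this
        omega
      · simp only [grp, side, pos, hu, hv, if_false] at e1 e2 e3
        have e1' : g u = g v := by omega
        rw [e1', e2] at e3
        exact hf (g v) (s v) (by simp [hC, e1', e2]) (by simp [hC]) e3
  · intro v
    by_cases hv : v ∈ Bad
    · simp only [pos, hv, if_true]
      exact Nat.mod_lt _ ht
    · simp only [pos, hv, if_false]
      have := hflt (g v) (s v) v (by simp [hC])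
      rwa [h1 _ (hgood v hv).1] at this
  · intro v
    by_cases hv : v ∈ Bad
    · exact (hgrpBad v hv).trans (Nat.le_add_right _ _)
    · simp only [grp, hv, if_false]
      have := (hgood v hv).1
      omega
  · calc ∑ v, grp v ≤ ∑ v, ((A + 1) + if v ∈ Bad then 0 else g v) := sum_le_sum fun v _ => by
          by_cases hv : v ∈ Bad
          · have := hgrpBad v hv
            simp only [hv, if_true]; omega
          · simp [grp, hv]
      _ = Fintype.card V * (A + 1) + ∑ v with v ∉ Bad, g v := by
          rw [sum_add_distrib, sum_filter]
          simp
      _ ≤ Fintype.card V * (A + 1) + ∑ v with g v ∈ range K, g v := by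
          gcongr with v
          intro hv
          exact mem_range.mpr (hgood v hv).1
      -- The source of the leading term: this sum is at most `t * K ^ 2`, and at `t` bits per group
      -- `2 * t * K ≤ card V` turns it into a quarter of the square of `card V`.
      _ = Fintype.card V * (A + 1) + ∑ i ∈ range K, 2 * t * i := by
          congr 1
          rw [← sum_fiberwise_of_maps_to (g := g) (t := range K) (fun v hv => (mem_filter.mp hv).2)]
          refine sum_congr rfl fun i hi => ?_
          rw [sum_congr rfl (g := fun _ => i) (fun v hv => (mem_filter.mp hv).2), sum_const,
            smul_eq_mul, ← hcard i (mem_range.mp hi), filter_filter]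
          congr 2
          ext v
          simp only [mem_filter, mem_univ, true_and]
          exact ⟨fun hv => hv.2, fun hv => ⟨hv ▸ hi, hv⟩⟩
      _ ≤ _ := by
          gcongr
          rw [← mul_sum, mul_comm 2 t, mul_assoc]
          gcongr
          rw [mul_comm, sum_range_id_mul_two, sq]
          gcongr
          omega
  · intro v
    have hsub : ∀ i b, ({u | grp u = A + 1 + i ∧ side u = b} : Finset V) ⊆ C i b := by
      intro i b u hu
      obtain ⟨-, hu1, hu2⟩ := mem_filter.mp hu
      by_cases hub : u ∈ Bad
      · have := hgrpBad u hub
        omega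
      · simp only [grp, side, hub, if_false] at hu1 hu2
        simp only [hC, mem_filter, mem_univ, true_and]
        exact ⟨by omega, hu2⟩
    by_cases hv : v ∈ Bad
    · refine (card_filter_le _ _).trans ?_
      have := hgrpBad v hv
      rw [card_range]
      omega
    · obtain ⟨hv1, hv2⟩ := hgood v hv
      have hgv : grp v = A + 1 + g v := by simp only [grp, hv, if_false]
      have hss : ({i ∈ range (grp v + 1) | Mixed T v {u | grp u = i ∧ side u = false} ∧
          Mixed T v {u | grp u = i ∧ side u = true}} : Finset ℕ) ⊆ range (A + 1) ∪
          ({i ∈ range K | i ≤ g v ∧ Mixed T v (C i false) ∧ Mixed T v (C i true)} : Finset ℕ).image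
            (fun i => A + 1 + i) := by
        intro i hi
        obtain ⟨hir, hi1, hi2⟩ := mem_filter.mp hi
        have hir' := mem_range.mp hir
        by_cases hiA : i < A + 1
        · exact mem_union_left _ (mem_range.mpr hiA)
        · obtain ⟨j, rfl⟩ := Nat.exists_eq_add_of_le (not_lt.mp hiA)
          refine mem_union_right _ (mem_image.mpr ⟨j, mem_filter.mpr ⟨mem_range.mpr (by omega),
            by omega, hi1.mono (hsub _ _), hi2.mono (hsub _ _)⟩, rfl⟩)
      refine (card_le_card hss).trans ((card_union_le _ _).trans ?_)
      rw [card_range]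
      exact Nat.add_le_add_left (card_image_le.trans hv2) _

end Grouping

/-! ### Labels of a directed graph -/

section Reachability

open Finset

variable {n : ℕ} (G : Digraph (Fin n))

open Classical in
/-- The number of nodes from which `v` can be reached. -/
noncomputable def ancestors (v : Fin n) : ℕ := #{x | Reaches G x v}

/-- One of the two nodes can be reached from the other. -/
def Linked (u v : Fin n) : Prop := Reaches G u v ∨ Reaches G v u

theorem ancestors_le (v : Fin n) : ancestors G v ≤ n := by
  classical
  simpa [ancestors] using card_le_univ ({x | Reaches G x v} : Finset (Fin n))

variable {G}

theorem ancestors_mono {u v : Fin n} (h : Reaches G u v) : ancestors G u ≤ ancestors G v := by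
  classical
  refine card_le_card fun x hx => ?_
  simp only [mem_filter, mem_univ, true_and] at hx ⊢
  exact Relation.ReflTransGen.trans hx h

/-- The ancestors of `v` are among those of `u`; by cardinality the sets agree, and `u` is an
ancestor of itself. -/
theorem reaches_of_ancestors_le {u v : Fin n} (h : Reaches G v u)
    (hle : ancestors G u ≤ ancestors G v) : Reaches G u v := by
  classical
  have hsub : ({x | Reaches G x v} : Finset (Fin n)) ⊆
      ({x | Reaches G x u} : Finset (Fin n)) := fun x hx => by
    simp only [mem_filter, mem_univ, true_and] at hx ⊢
    exact Relation.ReflTransGen.trans hx h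
  have heq := eq_of_subset_of_card_le hsub hle
  have hu : u ∈ ({x | Reaches G x u} : Finset (Fin n)) := by
    simp only [mem_filter, mem_univ, true_and]
    exact Relation.ReflTransGen.refl
  rw [← heq] at hu
  simpa using hu

/-- One number per node orients the symmetric relation; inside a strong component the numbers agree.
-/
theorem reaches_iff (u v : Fin n) :
    Reaches G u v ↔ ancestors G u ≤ ancestors G v ∧ Linked G u v :=
  ⟨fun h => ⟨ancestors_mono h, Or.inl h⟩, fun ⟨hle, h⟩ =>
    h.elim id fun h => reaches_of_ancestors_le h hle⟩

theorem Linked.symm {u v : Fin n} (h : Linked G u v) : Linked G v u := Or.symm h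

variable (G)

/-- The position of a node in the order by the number of ancestors. -/
noncomputable def topologicalIndex (v : Fin n) : ℕ :=
  #{x | toLex (ancestors G x, x) < toLex (ancestors G v, v)}

theorem topologicalIndex_lt (v : Fin n) : topologicalIndex G v < n := by
  have h : ({x | toLex (ancestors G x, x) < toLex (ancestors G v, v)} : Finset (Fin n)) ⊂ univ :=
    filter_ssubset.mpr ⟨v, mem_univ v, lt_irrefl _⟩
  simpa [topologicalIndex] using card_lt_card h

theorem topologicalIndex_lt_of_lt {u v : Fin n}
    (h : toLex (ancestors G u, u) < toLex (ancestors G v, v)) :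
    topologicalIndex G u < topologicalIndex G v := by
  refine card_lt_card ⟨fun x hx => ?_, fun hsub => ?_⟩
  · simp only [mem_filter, mem_univ, true_and] at hx ⊢
    exact hx.trans h
  · have := hsub (mem_filter.mpr ⟨mem_univ u, h⟩)
    exact lt_irrefl _ (mem_filter.mp this).2

theorem topologicalIndex_injective : Function.Injective (topologicalIndex G) := by
  intro u v huv
  rcases lt_trichotomy (toLex (ancestors G u, u)) (toLex (ancestors G v, v)) with h | h | h
  · exact absurd huv (topologicalIndex_lt_of_lt G h).ne
  · exact (Prod.mk.inj (toLex.injective h)).2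
  · exact absurd huv.symm (topologicalIndex_lt_of_lt G h).ne

theorem ancestors_le_of_topologicalIndex_lt {u v : Fin n}
    (h : topologicalIndex G u < topologicalIndex G v) : ancestors G u ≤ ancestors G v := by
  by_contra! hlt
  exact absurd h (not_lt.mpr (topologicalIndex_lt_of_lt G (Prod.Lex.toLex_lt_toLex.mpr
    (Or.inl hlt))).le)

/-- Along increasing layers the number of ancestors does not decrease, so links are forward paths
and compose. -/
theorem isLayered_linked (l : ℕ) :
    IsLayered (Linked G) (fun v => topologicalIndex G v / l) where
  symm _ _ h := h.symm
  trans u v z huv hvz h1 h2 := by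
    have e1 := ancestors_le_of_topologicalIndex_lt G (Nat.lt_of_div_lt_div huv)
    have e2 := ancestors_le_of_topologicalIndex_lt G (Nat.lt_of_div_lt_div hvz)
    exact Or.inl (Relation.ReflTransGen.trans ((reaches_iff u v).mpr ⟨e1, h1⟩)
      ((reaches_iff v z).mpr ⟨e2, h2⟩))

theorem card_layer_le {l : ℕ} (hl : 0 < l) (a : ℕ) :
    #{v | topologicalIndex G v / l = a} ≤ l := by
  have : #{v | topologicalIndex G v / l = a} ≤ #(Ico (a * l) (a * l + l)) := by
    refine card_le_card_of_injOn (topologicalIndex G) (fun v hv => ?_)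
      (topologicalIndex_injective G).injOn
    have hv' : topologicalIndex G v / l = a := by simpa using hv
    have := Nat.div_add_mod' (topologicalIndex G v) l
    have := Nat.mod_lt (topologicalIndex G v) hl
    rw [hv'] at *
    rw [mem_coe, mem_Ico]
    omega
  simpa using this

open Classical in
/-- The content of the label of a node, for a given grouping of the nodes. -/
noncomputable def labelData (k t : ℕ) (grp pos : Fin n → ℕ) (side : Fin n → Bool) (v : Fin n) :
    LabelData where
  k := k
  t := t
  rank := ancestors G v
  grp := grp v
  side := side v
  pos := pos v
  explicit i b := decide (Mixed (Linked G) v {u | grp u = i ∧ side u = b})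
  default i b := decide (∃ u, grp u = i ∧ side u = b ∧ Linked G v u)
  bit i b p := decide (∃ u, grp u = i ∧ side u = b ∧ pos u = p ∧ Linked G v u)

variable {G} {k t : ℕ} {grp pos : Fin n → ℕ} {side : Fin n → Bool}

/-- By injectivity an explicit bit speaks of `u` alone; on a side that is not mixed, one linked node
decides for all. -/
theorem value_labelData (hinj : Function.Injective fun v => (grp v, side v, pos v))
    (u v : Fin n) :
    (labelData G k t grp pos side v).value (grp u) (side u) (pos u) = true ↔ Linked G v u := by
  classical
  have e1 : (labelData G k t grp pos side v).explicit (grp u) (side u) = true ↔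
      Mixed (Linked G) v {x | grp x = grp u ∧ side x = side u} := by
    simp only [labelData, decide_eq_true_eq]
  rw [LabelData.value]
  split_ifs with h
  · simp only [labelData, decide_eq_true_eq]
    refine ⟨fun ⟨x, h1, h2, h3, h4⟩ => ?_, fun h => ⟨u, rfl, rfl, rfl, h⟩⟩
    have : x = u := hinj (by simp [h1, h2, h3])
    exact this ▸ h4
  · rw [e1] at h
    simp only [labelData, decide_eq_true_eq]
    refine ⟨fun ⟨x, h1, h2, h4⟩ => ?_, fun h => ⟨u, rfl, rfl, h⟩⟩
    by_contra hu
    exact h ⟨⟨x, by simp [h1, h2], h4⟩, ⟨u, by simp, hu⟩⟩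

-- Per group: 4 flag bits, `t` bits for one side, a relative pointer of `2 * k` bits, and 1 bit as
-- the share of an absolute pointer, which has `2 ^ k` bits and serves `2 ^ k` groups. Groups mixed
-- on both sides cost `t` more.
open Classical in
theorem length_label_labelData_le (v : Fin n) :
    (labelData G k t grp pos side v).label.length ≤
      10 * 2 ^ k + (grp v + 1) * (2 * k + 5 + t) +
        t * #{i ∈ range (grp v + 1) | Mixed (Linked G) v {u | grp u = i ∧ side u = false} ∧
          Mixed (Linked G) v {u | grp u = i ∧ side u = true}} := by
  set D := labelData G k t grp pos side v with hD
  have hdiv : grp v / 2 ^ k * 2 ^ k ≤ grp v := Nat.div_mul_le_self _ _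
  have hstart : D.start (grp v + 1) ≤ (grp v + 1) * (4 + t) +
      t * #{i ∈ range (grp v + 1) | Mixed (Linked G) v {u | grp u = i ∧ side u = false} ∧
          Mixed (Linked G) v {u | grp u = i ∧ side u = true}} := by
    rw [LabelData.start, card_filter, mul_sum]
    calc _ ≤ ∑ i ∈ range (grp v + 1), ((4 + t) +
          t * if Mixed (Linked G) v {u | grp u = i ∧ side u = false} ∧
            Mixed (Linked G) v {u | grp u = i ∧ side u = true} then 1 else 0) := by
          refine sum_le_sum fun i _ => ?_
          rw [LabelData.length_code]
          simp only [hD, labelData]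
          by_cases h1 : Mixed (Linked G) v {u | grp u = i ∧ side u = false} <;>
            by_cases h2 : Mixed (Linked G) v {u | grp u = i ∧ side u = true} <;>
            simp [h1, h2] <;> omega
      _ = _ := by rw [sum_add_distrib, sum_const, card_range, smul_eq_mul]
  have e1 : D.grp = grp v := rfl
  have e2 : D.k = k := rfl
  rw [LabelData.length_label, LabelData.codePos, LabelData.pointerPos, e1, e2]
  nlinarith

open Classical in
/-- A grouping of the nodes yields labels. -/
theorem exists_labels (hinj : Function.Injective fun v => (grp v, side v, pos v))
    (hpos : ∀ v, pos v < t) (ht : 2 * t + 4 ≤ 2 ^ k) (hk : 4 ≤ k)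
    (hgrp : ∀ v, grp v + 1 < 2 ^ (2 ^ k / 4)) (hn : n < 2 ^ 2 ^ k) :
    ∃ l : Fin n → List Bool, Function.Injective l ∧
      (∀ u v, WordRAM.Expr.decoder.eval (l u) (l v) ≠ 0 ↔ Reaches G u v) ∧
      (∀ w, 4 * 2 ^ k ≤ w → ∀ u v, WordRAM.Expr.decoder.Fits w (l u) (l v)) ∧
      ∀ v, (l v).length ≤ 10 * 2 ^ k + (grp v + 1) * (2 * k + 5 + t) +
        t * #{i ∈ range (grp v + 1) | Mixed (Linked G) v {u | grp u = i ∧ side u = false} ∧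
          Mixed (Linked G) v {u | grp u = i ∧ side u = true}} := by
  have hv : ∀ v, (labelData G k t grp pos side v).Valid := fun v =>
    ⟨(ancestors_le G v).trans_lt hn, hpos v, ht, hk, hgrp v⟩
  refine ⟨fun v => (labelData G k t grp pos side v).label, fun u v huv => ?_, fun u v => ?_,
    fun w hw u v => WordRAM.Expr.fits_decoder (hv u) (hv v) rfl hw, length_label_labelData_le⟩
  · by_contra hne
    refine LabelData.label_ne (hv u) (hv v) ?_ huv
    by_contra! hcon
    exact hne (hinj (Prod.ext hcon.1 (Prod.ext hcon.2.1 hcon.2.2)))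
  · rw [WordRAM.Expr.eval_decoder (hv u) (hv v) rfl, reaches_iff]
    refine and_congr_right fun _ => ?_
    have e1 := value_labelData (G := G) (k := k) (t := t) hinj u v
    have e2 := value_labelData (G := G) (k := k) (t := t) hinj v u
    split_ifs
    · exact e1.trans ⟨Linked.symm, Linked.symm⟩
    · exact e2

end Reachability

/-! ### The lower bound -/

section LowerBound

open Finset

/-- The number of tuples of `n` binary strings of total length at most `L`. -/
theorem card_le_of_injective_labels {α : Type*} [Fintype α] {n L : ℕ}
    (f : α → Fin n → List Bool) (hf : Function.Injective f)
    (hL : ∀ a, ∑ u, (f a u).length ≤ L) : Fintype.card α ≤ (L + 1) ^ n * 2 ^ L := by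
  have hlen : ∀ a u, (f a u).length < L + 1 := fun a u =>
    Nat.lt_succ_of_le ((single_le_sum (f := fun u => (f a u).length)
      (fun _ _ => Nat.zero_le _) (mem_univ u)).trans (hL a))
  -- A tuple is determined by its lengths and its concatenation, padded to `L` bits.
  let e : α → (Fin n → Fin (L + 1)) × (Fin L → Bool) := fun a =>
    (fun u => ⟨(f a u).length, hlen a u⟩, fun j => (List.ofFn (f a)).flatten.getD j false)
  have hflat : ∀ a, (List.ofFn (f a)).flatten.length = ∑ u, (f a u).length := fun a => by
    rw [List.length_flatten, List.map_ofFn, List.sum_ofFn]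
    rfl
  have he : Function.Injective e := by
    intro a b hab
    obtain ⟨h1, h2⟩ := Prod.mk.inj hab
    have h1' : ∀ u, (f a u).length = (f b u).length := fun u => by
      simpa using congrFun h1 u
    have hab' : (List.ofFn (f a)).flatten.length = (List.ofFn (f b)).flatten.length := by
      rw [hflat, hflat]
      exact sum_congr rfl fun u _ => h1' u
    apply hf
    apply List.ofFn_injective
    rw [List.eq_iff_flatten_eq]
    refine ⟨List.ext_getElem hab' fun j hj hj' => ?_, ?_⟩
    · have hjL : j < L := hj.trans_le ((hflat a).trans_le (hL a))
      have := congrFun h2 ⟨j, hjL⟩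
      simp only at this
      rwa [List.getD_eq_getElem _ _ hj, List.getD_eq_getElem _ _ hj'] at this
    · rw [List.map_ofFn, List.map_ofFn]
      congr 1
      exact funext h1'
  have := Fintype.card_le_of_injective e he
  simpa using this

/-- The directed bipartite graph with edges from the first `a` nodes to the next `b` nodes that are
given by a matrix. -/
def bipartiteDigraph (n a b : ℕ) (M : Fin a × Fin b → Bool) : Digraph (Fin n) where
  Adj u v := ∃ (i : Fin a) (j : Fin b), (u : ℕ) = i ∧ (v : ℕ) = a + j ∧ M (i, j) = true

theorem reaches_bipartiteDigraph {n a b : ℕ} (M : Fin a × Fin b → Bool) {u v : Fin n} {i : Fin a}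
    {j : Fin b} (hu : (u : ℕ) = i) (hv : (v : ℕ) = a + j) :
    Reaches (bipartiteDigraph n a b M) u v ↔ M (i, j) = true := by
  constructor
  · intro h
    rcases Relation.ReflTransGen.cases_head h with rfl | ⟨c, ⟨i', j', h1, h2, h3⟩, hcv⟩
    · omega
    · rcases Relation.ReflTransGen.cases_head hcv with rfl | ⟨d, ⟨i'', _, h4, _⟩, -⟩
      · have e1 : i' = i := Fin.ext (by omega)
        have e2 : j' = j := Fin.ext (by omega)
        rwa [e1, e2] at h3
      · omega
  · intro h
    exact Relation.ReflTransGen.single ⟨i, j, hu, hv, h⟩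

/-- The decoder recovers the matrix from the labels, so different matrices have different label
tuples. -/
theorem IsReachabilityScheme.two_pow_le {n : ℕ} {label : Digraph (Fin n) → Fin n → List Bool}
    {decode : List Bool → List Bool → Bool} (h : IsReachabilityScheme n label decode) {a b L : ℕ}
    (hab : a + b = n) (hL : ∀ G, ∑ u, (label G u).length ≤ L) :
    2 ^ (a * b) ≤ (L + 1) ^ n * 2 ^ L := by
  have := card_le_of_injective_labels
    (fun M : Fin a × Fin b → Bool => label (bipartiteDigraph n a b M)) (fun M M' hM => ?_)
    (fun M => hL _)
  · simpa using this
  · funext ⟨i, j⟩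
    let u : Fin n := ⟨i, by omega⟩
    let v : Fin n := ⟨a + j, by omega⟩
    have h1 := (h (bipartiteDigraph n a b M)).2 u v
    have h2 := (h (bipartiteDigraph n a b M')).2 u v
    rw [reaches_bipartiteDigraph M (u := u) (v := v) (i := i) (j := j) rfl rfl] at h1
    rw [reaches_bipartiteDigraph M' (u := u) (v := v) (i := i) (j := j) rfl rfl] at h2
    have hM' : label (bipartiteDigraph n a b M) = label (bipartiteDigraph n a b M') := hM
    rw [← hM', h1] at h2
    exact Bool.eq_iff_iff.mpr h2

/-- Halving the nodes gives `a * b ≥ (n² - 1) / 4`. The bound `L + 1 ≤ (n + 1) ^ 2` accounts for `2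
* (log n + 1)` bits per node, and the remaining 1 absorbs the rounding. -/
theorem IsReachabilityScheme.exists_averageLength_ge {n : ℕ}
    {label : Digraph (Fin n) → Fin n → List Bool} {decode : List Bool → List Bool → Bool}
    (h : IsReachabilityScheme n label decode) :
    ∃ G, (n : ℝ) / 4 - (2 * Nat.log 2 n + 3 : ℝ) ≤ averageLength (label G) := by
  rcases Nat.eq_zero_or_pos n with rfl | hn
  · refine ⟨⟨fun _ _ => False⟩, ?_⟩
    simp [averageLength]
  by_contra! hcon
  have hn' : (1 : ℝ) ≤ n := by exact_mod_cast hn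
  set x : ℝ := (n : ℝ) / 4 - (2 * Nat.log 2 n + 3 : ℝ) with hx
  have hsum : ∀ G, ((∑ u, (label G u).length : ℕ) : ℝ) ≤ n * x := fun G => by
    have := hcon G
    rw [averageLength, div_lt_iff₀ (by linarith)] at this
    push_cast
    linarith
  have hL : ∀ G, ∑ u, (label G u).length ≤ ⌊n * x⌋₊ := fun G => Nat.le_floor (hsum G)
  have h0 : 0 ≤ n * x := (Nat.cast_nonneg _).trans (hsum ⟨fun _ _ => False⟩)
  set L := ⌊n * x⌋₊ with hLdef
  have hLx : (L : ℝ) ≤ n * x := Nat.floor_le h0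
  have h1 := h.two_pow_le (a := n / 2) (b := n - n / 2) (by omega) hL
  have hlog : (0 : ℝ) ≤ Nat.log 2 n := Nat.cast_nonneg _
  have hLn : L + 1 ≤ (n + 1) ^ 2 := by
    have : (L : ℝ) + 1 ≤ ((n : ℝ) + 1) ^ 2 := by nlinarith
    exact_mod_cast this
  have h2 : n + 1 ≤ 2 ^ (Nat.log 2 n + 1) := Nat.lt_pow_succ_log_self (by norm_num) n
  have h3 : 2 ^ (n / 2 * (n - n / 2)) ≤ 2 ^ ((Nat.log 2 n + 1) * 2 * n + L) := by
    calc _ ≤ _ := h1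
      _ ≤ ((2 ^ (Nat.log 2 n + 1)) ^ 2) ^ n * 2 ^ L := by
          gcongr
          exact hLn.trans (Nat.pow_le_pow_left h2 2)
      _ = _ := by rw [← pow_mul, ← pow_mul, ← pow_add, mul_assoc]
  have h4 := (Nat.pow_le_pow_iff_right (by norm_num)).mp h3
  have h5 : n * n ≤ 4 * (n / 2 * (n - n / 2)) + 1 := by
    obtain ⟨m, hm | hm⟩ := Nat.even_or_odd' n
    · have e1 : n / 2 = m := by omega
      have e2 : n - n / 2 = m := by omega
      rw [e2, e1, hm]; nlinarith
    · have e1 : n / 2 = m := by omega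
      have e2 : n - n / 2 = m + 1 := by omega
      rw [e2, e1, hm]; nlinarith
  have h6 : (n : ℝ) * n ≤ 4 * ((Nat.log 2 n + 1) * 2 * n + L) + 1 := by
    exact_mod_cast h5.trans (Nat.add_le_add_right (Nat.mul_le_mul_left 4 h4) 1)
  nlinarith

theorem isLittleO_log_add :
    Asymptotics.IsLittleO Filter.atTop (fun n : ℕ => (2 * Nat.log 2 n + 3 : ℝ))
      (fun n : ℕ => (n : ℝ)) := by
  have hcast : Filter.Tendsto (fun n : ℕ => (n : ℝ)) Filter.atTop Filter.atTop :=
    tendsto_natCast_atTop_atTop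
  have h1 : Asymptotics.IsLittleO Filter.atTop (fun n : ℕ => Real.log n) (fun n : ℕ => (n : ℝ)) :=
    Real.isLittleO_log_id_atTop.comp_tendsto hcast
  have h2 : Asymptotics.IsBigO Filter.atTop (fun n : ℕ => (Nat.log 2 n : ℝ))
      (fun n : ℕ => Real.log n) := by
    refine Asymptotics.IsBigO.of_bound (1 / Real.log 2) (Filter.Eventually.of_forall fun n => ?_)
    have h3 := Real.natLog_le_logb n 2
    rw [Real.logb] at h3
    have h4 : (0 : ℝ) ≤ Nat.log 2 n := Nat.cast_nonneg _
    rw [Real.norm_of_nonneg h4, Real.norm_of_nonneg (Real.log_natCast_nonneg n)]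
    calc _ ≤ _ := h3
      _ = _ := by push_cast; ring
  have h3 : Asymptotics.IsLittleO Filter.atTop (fun _ : ℕ => (3 : ℝ)) (fun n : ℕ => (n : ℝ)) :=
    (Asymptotics.isLittleO_const_id_atTop (3 : ℝ)).comp_tendsto hcast
  exact ((h2.trans_isLittleO h1).const_mul_left 2).add h3

end LowerBound

/-! ### Choice of the parameters -/

section Parameters

open Finset Filter

/-- The logarithm of the width of the fields. -/
def widthLog (n : ℕ) : ℕ := Nat.clog 2 (4 * (Nat.log 2 n + 3))

theorem le_two_pow_widthLog (n : ℕ) : 4 * (Nat.log 2 n + 3) ≤ 2 ^ widthLog n :=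
  Nat.le_pow_clog (by norm_num) _

theorem two_pow_widthLog_lt (n : ℕ) : 2 ^ widthLog n < 8 * (Nat.log 2 n + 3) := by
  have h := Nat.pow_pred_clog_lt_self (b := 2) (by norm_num) (x := 4 * (Nat.log 2 n + 3)) (by omega)
  have h1 : 0 < widthLog n := Nat.clog_pos (by norm_num) (by omega)
  have h2 : 2 ^ widthLog n = 2 * 2 ^ (widthLog n - 1) := by
    rw [← pow_succ', Nat.sub_add_cancel h1]
  rw [h2]
  have h3 : 2 ^ (widthLog n - 1) < 4 * (Nat.log 2 n + 3) := h
  omega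

theorem four_le_widthLog (n : ℕ) : 4 ≤ widthLog n := by
  have h := le_two_pow_widthLog n
  by_contra! hlt
  have : 2 ^ widthLog n ≤ 2 ^ 3 := Nat.pow_le_pow_right (by norm_num) (by omega)
  omega

theorem four_mul_lt_two_pow (n : ℕ) : 4 * n < 2 ^ (2 ^ widthLog n / 4) := by
  have h1 : Nat.log 2 n + 3 ≤ 2 ^ widthLog n / 4 := by have := le_two_pow_widthLog n; omega
  have h2 : n < 2 ^ (Nat.log 2 n + 1) := Nat.lt_pow_succ_log_self (by norm_num) n
  calc 4 * n < 4 * 2 ^ (Nat.log 2 n + 1) := by omega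
    _ = 2 ^ (Nat.log 2 n + 3) := by ring
    _ ≤ _ := Nat.pow_le_pow_right (by norm_num) h1

theorem lt_two_pow_two_pow (n : ℕ) : n < 2 ^ 2 ^ widthLog n := by
  have h1 := four_mul_lt_two_pow n
  have h2 : 2 ^ (2 ^ widthLog n / 4) ≤ 2 ^ 2 ^ widthLog n :=
    Nat.pow_le_pow_right (by norm_num) (Nat.div_le_self _ _)
  omega

theorem tendsto_widthLog : Tendsto widthLog atTop atTop := by
  refine tendsto_atTop_atTop.mpr fun b => ⟨2 ^ 2 ^ b, fun n hn => ?_⟩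
  have h1 : 2 ^ b ≤ Nat.log 2 n := by
    calc 2 ^ b = Nat.log 2 (2 ^ 2 ^ b) := (Nat.log_pow (by norm_num) _).symm
      _ ≤ _ := Nat.log_mono_right hn
  have h2 := le_two_pow_widthLog n
  exact (Nat.pow_le_pow_iff_right (by norm_num : 1 < 2)).mp (by omega)

/-- The label lengths in all directed graphs on `n` nodes exceed the bounds by at most `c`. -/
def HasShortLabels (n : ℕ) (c : ℝ) : Prop :=
  ∀ G : Digraph (Fin n), ∃ l : Fin n → List Bool, Function.Injective l ∧
    (∀ u v, WordRAM.Expr.decoder.eval (l u) (l v) ≠ 0 ↔ Reaches G u v) ∧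
    (∀ w, 4 * 2 ^ widthLog n ≤ w → ∀ u v, WordRAM.Expr.decoder.Fits w (l u) (l v)) ∧
    averageLength l ≤ n / 4 + c ∧ ∀ u, ((l u).length : ℝ) ≤ n / 2 + c

theorem HasShortLabels.mono {n : ℕ} {c d : ℝ} (h : HasShortLabels n c) (hcd : c ≤ d) :
    HasShortLabels n d := fun G => by
  obtain ⟨l, h1, h2, h3, h4, h5⟩ := h G
  exact ⟨l, h1, h2, h3, by linarith, fun u => by have := h5 u; linarith⟩

theorem averageLength_le {n : ℕ} (l : Fin n → List Bool) {c : ℝ} (hc : 0 ≤ c)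
    (h : ((∑ u, (l u).length : ℕ) : ℝ) ≤ n * c) : averageLength l ≤ c := by
  rw [averageLength]
  rcases Nat.eq_zero_or_pos n with rfl | hn
  · simpa using hc
  · rw [div_le_iff₀ (by exact_mod_cast hn)]
    push_cast at h
    linarith

/-- Covers small `n`, where the sharp estimates do not apply: every node forms its own group, with
`t = 1`. -/
theorem exists_hasShortLabels (n : ℕ) : ∃ c, HasShortLabels n c := by
  classical
  set m := 10 * 2 ^ widthLog n + (n + 1) * (2 * widthLog n + 5 + 1) + 1 * (n + 1) with hm
  refine ⟨m, fun G => ?_⟩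
  have hk := four_le_widthLog n
  obtain ⟨l, h1, h2, h3, h4⟩ := exists_labels (G := G) (k := widthLog n) (t := 1) (grp := fun v => v)
    (pos := fun _ => 0) (side := fun _ => false)
    (fun u v huv => by simpa [Fin.val_inj] using huv) (fun _ => by norm_num)
    (by calc 2 * 1 + 4 ≤ 2 ^ 4 := by norm_num
          _ ≤ _ := Nat.pow_le_pow_right (by norm_num) hk) hk
    (fun v => by have := four_mul_lt_two_pow n; have := v.2; omega) (lt_two_pow_two_pow n)
  have hl : ∀ v, (l v).length ≤ m := fun v => by
    refine (h4 v).trans ?_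
    have hv : (v : ℕ) + 1 ≤ n + 1 := by omega
    have hc : #{i ∈ range ((v : ℕ) + 1) | Mixed (Linked G) v {u | (u : ℕ) = i ∧ false = false} ∧
        Mixed (Linked G) v {u | (u : ℕ) = i ∧ false = true}} ≤ n + 1 :=
      (card_filter_le _ _).trans (by rw [card_range]; exact hv)
    rw [hm]
    gcongr
  refine ⟨l, h1, h2, h3, averageLength_le l (by positivity) ?_, fun u => ?_⟩
  · have : ∑ u, (l u).length ≤ n * m := by
      simpa using sum_le_card_nsmul univ _ m fun u _ => hl u
    have h5 : ((∑ u, (l u).length : ℕ) : ℝ) ≤ n * m := by exact_mod_cast this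
    have h6 : (0 : ℝ) ≤ n * (n / 4) := by positivity
    nlinarith
  · have h5 : ((l u).length : ℝ) ≤ m := by exact_mod_cast hl u
    have h6 : (0 : ℝ) ≤ n / 2 := by positivity
    linarith

open Classical in
/-- A grouping of the nodes with few exceptional groups for each node. -/
theorem exists_grouping {n E t : ℕ} (G : Digraph (Fin n)) (hE : 0 < E) (ht : 0 < t)
    (hbig : E ^ 2 * (E ^ 2 * 2 ^ (t * (2 * E ^ 2 * t) ^ E ^ 2) * t) ≤ n) :
    ∃ (A K τ : ℕ) (grp pos : Fin n → ℕ) (side : Fin n → Bool),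
      Function.Injective (fun v => (grp v, side v, pos v)) ∧ (∀ v, pos v < t) ∧
      2 * t * K ≤ n ∧ E * (t * A) ≤ 3 * n + E ^ 2 + E * t ∧ E * (t * τ) ≤ n ∧
      (∀ v, grp v + 1 ≤ A + K) ∧ ∑ v, grp v ≤ n * A + t * K ^ 2 ∧
      ∀ v, #{i ∈ range (grp v + 1) | Mixed (Linked G) v {u | grp u = i ∧ side u = false} ∧
        Mixed (Linked G) v {u | grp u = i ∧ side u = true}} ≤ A + τ := by
  -- There are `E ^ 2` layers, and at most `4 * h + 2` nodes are mixed to both sides of a group. The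
  -- threshold `τ` costs at most `n / E` bits per label, and with at most `n / (2 * t)` groups it
  -- leaves only `O(n / E + E)` exceptional nodes.
  obtain ⟨h, hh⟩ : ∃ h, h = n / E ^ 2 := ⟨_, rfl⟩
  obtain ⟨τ, hτ⟩ : ∃ τ, τ = n / (t * E) := ⟨_, rfl⟩
  have hEE : 0 < E ^ 2 := by positivity
  have hn_lt : n < E ^ 2 * (h + 1) := hh ▸ Nat.lt_mul_div_succ n hEE
  have hh_le : E ^ 2 * h ≤ n := hh ▸ Nat.mul_div_le n _
  have hbig' : E ^ 2 * 2 ^ (t * (2 * E ^ 2 * t) ^ E ^ 2) * t ≤ h := by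
    rw [hh, Nat.le_div_iff_mul_le hEE, mul_comm]
    exact hbig
  have hh1 : 1 ≤ h := le_trans (Nat.mul_pos (Nat.mul_pos hEE (by positivity)) ht) hbig'
  have hτ_lt : n < t * E * (τ + 1) := hτ ▸ Nat.lt_mul_div_succ n (by positivity)
  have hτ_le : t * E * τ ≤ n := hτ ▸ Nat.mul_div_le n _
  -- Rounding `n / E ^ 2` down loses at most a factor 2, as `h ≥ 1`; hence the 2 in `M`.
  have hM : Fintype.card (Fin n) * t ≤ h * (2 * E ^ 2 * t) := by
    have : n ≤ h * (2 * E ^ 2) := by nlinarith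
    rw [Fintype.card_fin]
    calc n * t ≤ h * (2 * E ^ 2) * t := Nat.mul_le_mul_right _ this
      _ = _ := by ring
  have hpair := (isLayered_linked G (h + 1)).exists_pair (Q := E ^ 2) (l := h + 1) (t := t)
    (M := 2 * E ^ 2 * t) (h := h)
    (fun v => (Nat.div_lt_iff_lt_mul (by omega)).mpr ((topologicalIndex_lt G v).trans hn_lt))
    (fun a => card_layer_le G (l := h + 1) (by omega) a) ht (by positivity) hM hbig'
  obtain ⟨K, g, sd, c1, c2, c3⟩ := exists_greedy_grouping (Linked G) ht hpair univ
  obtain ⟨B, grp, pos, side, d1, d2, d3, d4, d5, d6, d7⟩ := exists_grouping_of_greedy (Linked G) τ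
    ht g sd c1 c2 c3
  rw [Fintype.card_fin] at d3 d6
  have hB : 2 * B ≤ 2 * h + E * (2 * (h + 1) + 2 * h) := by
    have e1 : 2 * K ≤ E * (τ + 1) := by
      have : t * (2 * K) ≤ t * (E * (τ + 1)) := by nlinarith
      exact Nat.le_of_mul_le_mul_left this ht
    have e2 : 2 * B * (τ + 1) ≤ (2 * h + E * (2 * (h + 1) + 2 * h)) * (τ + 1) := by
      have := Nat.mul_le_mul_right (2 * (h + 1) + 2 * h) e1
      nlinarith
    exact Nat.le_of_mul_le_mul_right e2 (Nat.succ_pos _)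
  refine ⟨B / (2 * t) + 1, K, τ, grp, pos, side, d1, d2, d3, ?_, by linarith, fun v => ?_, d6, d7⟩
  · have e1 := Nat.div_mul_le_self B (2 * t)
    have e2 : E * B ≤ E * h + E * E * (2 * h + 1) := by nlinarith
    have e3 : E * h ≤ E * E * h := Nat.mul_le_mul_right _ (Nat.le_mul_of_pos_left _ hE)
    nlinarith
  · have := d5 v
    omega

/-- Here `N = n / E` is the unit of error, `S` the total number of described groups and `k` the
overhead per group. The leading term is `t * S`, through `(t * K) ^ 2 ≤ (n / 2) ^ 2`; the overhead
is at most a fraction `4 / E` of `t`. -/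
theorem total_length_bound {n N E k t A K τ P S : ℝ} (hE : 0 < E) (hN : N * E = n) (hn : 0 ≤ n)
    (hN0 : 0 ≤ N) (hNn : N ≤ n) (ht : 0 ≤ t) (hK0 : 0 ≤ K) (hP : P ≤ N) (hτ : t * τ ≤ N)
    (htN : t ≤ N) (hA : t * A ≤ 5 * N) (hK : t * K ≤ n / 2) (hk : k * E ≤ 4 * t) (hS0 : 0 ≤ S)
    (hS : S ≤ n * A + t * K ^ 2 + n) :
    n * P + S * (k + t) + n * (t * (A + τ)) ≤ n * (n / 4 + 40 * N) := by
  have e3 : t * S ≤ n * (n / 4) + 6 * (n * N) := by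
    have e4 : (t * K) ^ 2 ≤ (n / 2) ^ 2 := pow_le_pow_left₀ (by positivity) hK 2
    have e5 : n * (t * A) ≤ n * (5 * N) := mul_le_mul_of_nonneg_left hA hn
    have e6 : n * t ≤ n * N := mul_le_mul_of_nonneg_left htN hn
    calc t * S ≤ t * (n * A + t * K ^ 2 + n) := mul_le_mul_of_nonneg_left hS ht
      _ = n * (t * A) + (t * K) ^ 2 + n * t := by ring
      _ ≤ n * (5 * N) + (n / 2) ^ 2 + n * N := by linarith
      _ = _ := by ring
  have hnN : n * N ≤ n * n := mul_le_mul_of_nonneg_left hNn hn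
  have e4 : k * S ≤ 25 * (n * N) := by
    have h1 : E * (k * S) ≤ E * (25 * (n * N)) := by
      calc E * (k * S) = k * E * S := by ring
        _ ≤ 4 * t * S := mul_le_mul_of_nonneg_right hk hS0
        _ ≤ 25 * (n * n) := by linarith
        _ = n * 25 * (N * E) := by rw [hN]; ring
        _ = _ := by ring
    exact le_of_mul_le_mul_left h1 hE
  have e5 : n * P ≤ n * N := mul_le_mul_of_nonneg_left hP hn
  have e6 : n * (t * (A + τ)) ≤ n * (6 * N) := mul_le_mul_of_nonneg_left (by linarith) hn
  have e7 : 0 ≤ n * N := mul_nonneg hn hN0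
  linarith

theorem length_bound {n N E k t A K τ P g : ℝ} (hE : 0 < E) (hN : N * E = n) (hN0 : 0 ≤ N)
    (hNn : N ≤ n) (ht : 0 ≤ t) (hk0 : 0 ≤ k) (hA0 : 0 ≤ A) (hK0 : 0 ≤ K) (hP : P ≤ N)
    (hτ : t * τ ≤ N) (hA : t * A ≤ 5 * N) (hK : t * K ≤ n / 2) (hk : k * E ≤ 4 * t)
    (hg : g ≤ A + K) :
    P + g * (k + t) + t * (A + τ) ≤ n / 2 + 40 * N := by
  have e3 : k * (A + K) ≤ 22 * N := by
    have h1 : E * (k * (A + K)) ≤ E * (22 * N) := by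
      calc E * (k * (A + K)) = k * E * (A + K) := by ring
        _ ≤ 4 * t * (A + K) := mul_le_mul_of_nonneg_right hk (by linarith)
        _ ≤ 22 * (N * E) := by linarith
        _ = _ := by ring
    exact le_of_mul_le_mul_left h1 hE
  have e4 : g * (k + t) ≤ (A + K) * (k + t) := mul_le_mul_of_nonneg_right hg (by linarith)
  linarith

-- The choice `t = E * widthLog n` makes pointers a fraction `O(1 / E)` of the side size. The second
-- hypothesis on the parameters supplies the room needed for the pigeonhole argument.
open Classical in
theorem hasShortLabels_of_le {n E : ℕ} (hE : 0 < E)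
    (h1 : 2 * (E * widthLog n) + 4 ≤ 2 ^ widthLog n)
    (h2 : 2 ^ (E * widthLog n * (2 * E ^ 2 * (E * widthLog n)) ^ E ^ 2 + widthLog n + E ^ 5 + 6) ≤ n) :
    HasShortLabels n (40 * (n / E)) := by
  have hw := four_mul_lt_two_pow n
  have hw2 := lt_two_pow_two_pow n
  have hk4 := four_le_widthLog n
  obtain ⟨k, hk⟩ : ∃ k, k = widthLog n := ⟨_, rfl⟩
  intro G
  rw [← hk] at h1 h2 hw hw2 hk4 ⊢
  obtain ⟨t, ht⟩ : ∃ t, t = E * k := ⟨_, rfl⟩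
  rw [← ht] at h1 h2
  have ht0 : 0 < t := by rw [ht]; exact Nat.mul_pos hE (by omega)
  have hk2 : k < 2 ^ k := Nat.lt_two_pow_self
  have hE2 : E ^ 5 < 2 ^ E ^ 5 := Nat.lt_two_pow_self
  have hE5 : E ≤ E ^ 5 := Nat.le_self_pow (by norm_num) E
  obtain ⟨s, hs⟩ : ∃ s, s = t * (2 * E ^ 2 * t) ^ E ^ 2 := ⟨_, rfl⟩
  rw [← hs] at h2
  have hn1 : 64 * (2 ^ E ^ 5 * 2 ^ s * 2 ^ k) ≤ n := by
    calc _ = 2 ^ (s + k + E ^ 5 + 6) := by ring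
      _ ≤ n := h2
  have hs1 : 1 ≤ 2 ^ s := Nat.one_le_two_pow
  have hbig : E ^ 2 * (E ^ 2 * 2 ^ s * t) ≤ n := by
    calc E ^ 2 * (E ^ 2 * 2 ^ s * t) = E ^ 5 * 2 ^ s * k := by rw [ht]; ring
      _ ≤ 2 ^ E ^ 5 * 2 ^ s * 2 ^ k := by gcongr
      _ ≤ n := by omega
  have hbig2 : E * (10 * 2 ^ k) ≤ n := by
    calc E * (10 * 2 ^ k) = 10 * (E * 1 * 2 ^ k) := by ring
      _ ≤ 10 * (2 ^ E ^ 5 * 2 ^ s * 2 ^ k) := by gcongr; omega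
      _ ≤ n := by omega
  have hbig3 : E * (E * t) ≤ n := by
    calc E * (E * t) = E ^ 2 * (1 * 1 * t) := by ring
      _ ≤ E ^ 2 * (E ^ 2 * 2 ^ s * t) := by gcongr; exact Nat.one_le_pow _ _ hE
      _ ≤ n := hbig
  obtain ⟨A, K, τ, grp, pos, side, d1, d2, d3, d4, d5, d6, d7, d8⟩ :=
    exists_grouping G hE ht0 (hs ▸ hbig)
  set N : ℝ := (n : ℝ) / E with hN
  have hE' : (1 : ℝ) ≤ E := by exact_mod_cast hE
  have hE0 : (0 : ℝ) < E := by linarith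
  have le_N : ∀ a c : ℕ, E * a ≤ c * n → (a : ℝ) ≤ c * N := fun a c ha => by
    rw [hN, ← mul_div_assoc, le_div_iff₀ hE0, mul_comm]; exact_mod_cast ha
  have hN0 : 0 ≤ N := by positivity
  have rN : N ≤ n := div_le_self (Nat.cast_nonneg _) hE'
  have r1 : (10 : ℝ) * 2 ^ k ≤ N := by
    have := le_N (10 * 2 ^ k) 1 (by omega)
    push_cast at this
    linarith
  have r3 : (t : ℝ) * τ ≤ N := by
    have := le_N (t * τ) 1 (by omega)
    push_cast at this
    linarith
  have hEt : E * t ≤ n := le_trans (Nat.le_mul_of_pos_left _ hE) hbig3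
  have hE2 : E ^ 2 ≤ n := by nlinarith
  have r5 : (t : ℝ) ≤ N := by
    have := le_N t 1 (by omega)
    push_cast at this
    linarith
  have r8 : (t : ℝ) * A ≤ 5 * N := by
    have := le_N (t * A) 5 (by omega)
    push_cast at this
    linarith
  have r9 : (t : ℝ) * K ≤ n / 2 := by
    have : (2 * t * K : ℝ) ≤ n := by exact_mod_cast d3
    linarith
  have rt : (0 : ℝ) < t := by exact_mod_cast ht0
  have hAK : A + K ≤ 4 * n := by
    have e1 : 4 ≤ t := by rw [ht]; nlinarith
    have e2 : (4 : ℝ) ≤ t := by exact_mod_cast e1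
    have e3 : (4 : ℝ) * (A + K) ≤ t * (A + K) := by gcongr
    have e4 : ((A + K : ℕ) : ℝ) ≤ (4 * n : ℕ) := by
      push_cast
      linarith [Nat.cast_nonneg (α := ℝ) n]
    exact_mod_cast e4
  have rk : (2 * k + 5 : ℝ) * E ≤ 4 * t := by
    have : (2 * k + 5) * E ≤ 4 * t := by rw [ht]; nlinarith
    exact_mod_cast this
  have hNE : N * E = n := div_mul_cancel₀ _ hE0.ne'
  obtain ⟨l, l1, l2, l3, l4⟩ := exists_labels (G := G) (k := k) (t := t) d1 d2 h1 hk4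
    (fun v => ((d6 v).trans hAK).trans_lt hw) hw2
  have hlen : ∀ v, ((l v).length : ℝ) ≤
      10 * 2 ^ k + (grp v + 1) * (2 * k + 5 + t) + t * (A + τ) := fun v => by
    have := (l4 v).trans (Nat.add_le_add_left (Nat.mul_le_mul_left t (d8 v)) _)
    exact_mod_cast this
  refine ⟨l, l1, l2, l3, averageLength_le l (by positivity) ?_, fun v => ?_⟩
  · have e1 : ((∑ v, (l v).length : ℕ) : ℝ) ≤
        ∑ v : Fin n, (10 * 2 ^ k + (grp v + 1) * (2 * k + 5 + t) + t * (A + τ) : ℝ) := by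
      push_cast
      exact sum_le_sum fun v _ => hlen v
    have e2 : ∑ v : Fin n, (10 * 2 ^ k + (grp v + 1) * (2 * k + 5 + t) + t * (A + τ) : ℝ) =
        n * (10 * 2 ^ k) + ((∑ v, grp v : ℕ) + n) * (2 * k + 5 + t) + n * (t * (A + τ)) := by
      rw [sum_add_distrib, sum_add_distrib, ← sum_mul _ _ (2 * k + 5 + t : ℝ), sum_add_distrib,
        sum_const, sum_const, sum_const]
      simp
    have e3 : ((∑ v, grp v : ℕ) : ℝ) ≤ n * A + t * K ^ 2 := by exact_mod_cast d7
    exact (e1.trans_eq e2).trans (total_length_bound hE0 hNE (Nat.cast_nonneg _) hN0 rN rt.le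
      (Nat.cast_nonneg _) r1 r3 r5 r8 r9 rk (by positivity) (by linarith))
  · exact (hlen v).trans (length_bound hE0 hNE hN0 rN rt.le (by positivity) (Nat.cast_nonneg _)
      (Nat.cast_nonneg _) r1 r3 r8 r9 rk (by exact_mod_cast d6 v))

theorem eventually_mul_pow_le_two_pow (C d : ℕ) : ∀ᶠ k : ℕ in atTop, C * k ^ d ≤ 2 ^ k := by
  have h := isLittleO_pow_const_const_pow_of_one_lt (R := ℝ) d (r := 2) (by norm_num)
  filter_upwards [h.bound (c := 1 / (C + 1)) (by positivity)] with k hk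
  rw [Real.norm_of_nonneg (by positivity), Real.norm_of_nonneg (by positivity), one_div,
    inv_mul_eq_div, le_div_iff₀ (by positivity)] at hk
  have h1 : (C * k ^ d : ℝ) ≤ 2 ^ k := by
    have : (0 : ℝ) ≤ (k : ℝ) ^ d := by positivity
    linarith
  exact_mod_cast h1

/-- For fixed `E` the exponent is a polynomial in `k = widthLog n`, while `log n` exceeds `2 ^ k / 8
- 3`. -/
theorem eventually_parameters (E : ℕ) : ∀ᶠ n in atTop,
    2 * (E * widthLog n) + 4 ≤ 2 ^ widthLog n ∧
    2 ^ (E * widthLog n * (2 * E ^ 2 * (E * widthLog n)) ^ E ^ 2 + widthLog n + E ^ 5 + 6) ≤ n := by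
  filter_upwards [tendsto_widthLog.eventually (eventually_mul_pow_le_two_pow
    (8 * (E * (2 * E ^ 3) ^ E ^ 2 + 2 * E + 1 + E ^ 5 + 8)) (E ^ 2 + 1))] with n hn
  have h1 := two_pow_widthLog_lt n
  have hk := four_le_widthLog n
  generalize widthLog n = k at *
  have hkd : k ≤ k ^ (E ^ 2 + 1) := Nat.le_self_pow (by omega) k
  have hs : E * k * (2 * E ^ 2 * (E * k)) ^ E ^ 2 = E * (2 * E ^ 3) ^ E ^ 2 * k ^ (E ^ 2 + 1) := by
    rw [show 2 * E ^ 2 * (E * k) = 2 * E ^ 3 * k by ring, mul_pow, pow_succ]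
    ring
  rw [hs]
  have h2 : 2 * E * k ≤ 2 * E * k ^ (E ^ 2 + 1) := Nat.mul_le_mul_left _ hkd
  have h3 : (E ^ 5 + 8) * 1 ≤ (E ^ 5 + 8) * k ^ (E ^ 2 + 1) := Nat.mul_le_mul_left _ (by omega)
  have h4 : 8 * (E * (2 * E ^ 3) ^ E ^ 2 * k ^ (E ^ 2 + 1) + 2 * E * k + k + E ^ 5 + 8) ≤ 2 ^ k := by
    refine le_trans ?_ hn
    calc _ ≤ 8 * (E * (2 * E ^ 3) ^ E ^ 2 * k ^ (E ^ 2 + 1) + 2 * E * k ^ (E ^ 2 + 1) +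
          k ^ (E ^ 2 + 1) + (E ^ 5 + 8) * k ^ (E ^ 2 + 1)) := by omega
      _ = _ := by ring
  constructor
  · rw [← mul_assoc]
    omega
  · refine le_trans (Nat.pow_le_pow_right (by norm_num) ?_) (Nat.pow_log_le_self 2 (x := n) ?_)
    · omega
    · rintro rfl
      simp only [Nat.log_zero_right] at h1
      omega

/-- Diagonal choice: each `n` uses the largest `j ≤ n` whose bound already holds, and `c n` if that
fails. -/
theorem exists_isLittleO_of_eventually {P : ℕ → ℝ → Prop}
    (hex : ∀ n, ∃ c, P n c)
    (hev : ∀ j : ℕ, ∀ᶠ n in atTop, P n (n / (j + 1))) :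
    ∃ ε : ℕ → ℝ, Asymptotics.IsLittleO atTop ε (fun n : ℕ => (n : ℝ)) ∧ ∀ n, P n (ε n) := by
  classical
  choose c hc using hex
  let m : ℕ → ℕ := fun n => Nat.findGreatest (fun j => P n (n / (j + 1))) n
  refine ⟨fun n => if P n (n / (m n + 1)) then n / (m n + 1) else c n, ?_, fun n => ?_⟩
  · refine Asymptotics.isLittleO_iff.mpr fun η hη => ?_
    obtain ⟨j, hj⟩ := exists_nat_one_div_lt hη
    filter_upwards [hev j, eventually_ge_atTop j] with n hn hjn
    have h1 : j ≤ m n := Nat.le_findGreatest hjn hn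
    have h2 : P n (n / (m n + 1)) := Nat.findGreatest_spec (P := fun j => P n (n / (j + 1))) hjn hn
    rw [if_pos h2, Real.norm_of_nonneg (by positivity), Real.norm_of_nonneg (by positivity)]
    calc (n : ℝ) / (m n + 1) ≤ n / (j + 1) := by gcongr
      _ = 1 / (j + 1) * n := by ring
      _ ≤ η * n := by gcongr
  · by_cases h : P n (n / (m n + 1))
    · simp only [h, if_true]
    · simp only [h, if_false]; exact hc n

theorem exists_isLittleO_hasShortLabels :
    ∃ ε : ℕ → ℝ, Asymptotics.IsLittleO atTop ε (fun n : ℕ => (n : ℝ)) ∧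
      ∀ n, HasShortLabels n (ε n) := by
  refine exists_isLittleO_of_eventually exists_hasShortLabels
    fun j => ?_
  filter_upwards [eventually_parameters (40 * (j + 1))] with n hn
  refine (hasShortLabels_of_le (by positivity) hn.1 hn.2).mono (le_of_eq ?_)
  push_cast
  field_simp

end Parameters

theorem mainTheorem2 :
    (∃ (label : (n : ℕ) → Digraph (Fin n) → Fin n → List Bool)
        (decode : List Bool → List Bool → Bool),
      (∀ n : ℕ, IsReachabilityScheme n (label n) decode) ∧
      ConstantTimeDecoder label decode ∧
      ∃ ε : ℕ → ℝ, Asymptotics.IsLittleO Filter.atTop ε (fun n : ℕ => (n : ℝ)) ∧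
        ∀ (n : ℕ) (G : Digraph (Fin n)),
          averageLength (label n G) ≤ (n : ℝ) / 4 + ε n ∧
          ∀ u : Fin n, ((label n G u).length : ℝ) ≤ (n : ℝ) / 2 + ε n) ∧
    (∃ ε : ℕ → ℝ, Asymptotics.IsLittleO Filter.atTop ε (fun n : ℕ => (n : ℝ)) ∧
      ∀ (n : ℕ) (label : Digraph (Fin n) → Fin n → List Bool)
        (decode : List Bool → List Bool → Bool),
        IsReachabilityScheme n label decode →
          ∃ G : Digraph (Fin n), (n : ℝ) / 4 - ε n ≤ averageLength (label G)) := by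
  refine ⟨?_, fun n => 2 * Nat.log 2 n + 3, isLittleO_log_add,
    fun n label decode h => h.exists_averageLength_ge⟩
  obtain ⟨ε, hε, hP⟩ := exists_isLittleO_hasShortLabels
  choose label h1 h2 h3 h4 h5 using hP
  refine ⟨label, fun x y => decide (WordRAM.Expr.decoder.eval x y ≠ 0), fun n G =>
    ⟨h1 n G, fun u v => by simpa using h2 n G u v⟩, ?_, ε, hε, fun n G => ⟨h4 n G, h5 n G⟩⟩
  -- The constant: `4 * 2 ^ widthLog n < 32 * (log n + 3) ≤ 96 * (log n + 1)`.
  refine ⟨WordRAM.Expr.decoder.program, _, 96, fun n w hw G u v =>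
    WordRAM.Expr.run_program ?_ _ _ _ (h3 n G w ?_ u v)⟩
  · omega
  · have := two_pow_widthLog_lt n
    omega
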